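/- **Setting.** There are $M$ sources, $N$ channels and $N$ dummy bandits. Source $m$ has an error function $p_m:\{0,1,2,\dots\}\to\mathbb R$, a weight $w_m>0$, a buffer of size $B_m\ge 1$, and i.i.d. integer transmission times $T_{m,0},T_{m,1},\dots\ge 1$ with finite mean and the law of $T_m$. Feature $i$ of source $m$ is submitted in slot $S_{m,i}$ from buffer position $b_{m,i}\in\{0,\dots,B_m-1\}$ and delivered in slot $D_{m,i}=S_{m,i}+T_{m,i}\le S_{m,i+1}$, where $S_{m,0}=0$ and $b_{m,0}$ and the initial age $\Delta_m(0)$ are given constants. A causal policy chooses $S_{m,i+1}<\infty$ and $b_{m,i+1}$ as functions of $T_{m,0},\dots,T_{m,i}$. The age is $\Delta_m(t)=t-\max\{S_{m,i}-b_{m,i}: D_{m,i}\le t\}$ (and $\Delta_m(0)+t$ for $t<D_{m,0}$), $c_m(t)\in\{0,1\}$ indicates whether a feature of source $m$ is under service in slot $t$, and $d_m(t)$ is the time already spent on that feature ($0$ if there is none). The source is active at $t$ if a feature is submitted at $t$, and passive otherwise. For a transmission cost $\lambda\in\mathbb R$ let $$\bar p_{m,opt}(\lambda)=\inf_{\text{causal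 policies}}\ \limsup_{n\to\infty}\mathbb E\Big[\frac1n\sum_{t=0}^{n-1}\big(w_mp_m(\Delta_m(t))+\lambda c_m(t)\big)\Big]\in[-\infty,\infty],$$ $$\gamma_m(\delta)=\inf_{\tau\ge1}\frac1\tau\sum_{k=0}^{\tau-1}\mathbb E[w_mp_m(\delta+k+T_m)],\qquad \ell_m=\liminf_{n\to\infty}\frac1n\sum_{k=0}^{n-1}w_mp_m(k).$$ It is assumed that $\sum_{k=0}^{T_m-1}p_m(\delta+k)$ is integrable for every $m$ and $\delta$ (this holds if $p_m$ is bounded). The passive set $\Omega_m(\lambda)$ of source $m$ is the set of states $(\delta,d)$ in which the optimal action is passive: either $d>0$, or $d=0$ and waiting time $\tau=0$ does not attain the minimum over $\tau\in\{0,1,\dots\}$, $b\in\{0,\dots,B_m-1\}$ in the average-cost optimality equation $$h(\delta)=\inf_{\tau,b}\Big\{\mathbb E\Big[\sum_{k=0}^{\tau+T_m-1}\big(w_mp_m(\delta+k)-\bar p_{m,opt}(\lambda)\big)\Big]+\lambda\mathbb E[T_m]+\mathbb E[h(T_m+b)]\Big\},$$ that is, some $\tau\ge 1$ satisfies $\mathbb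 E\big[\sum_{k<\tau+T_m}w_mp_m(\delta+k)\big]-\mathbb E\big[\sum_{k<T_m}w_mp_m(\delta+k)\big]<\tau\,\bar p_{m,opt}(\lambda)$. A dummy bandit has zero penalty and costs $\lambda$ in every slot in which it is activated; its passive set $\Omega_0(\lambda)$ is the set of states in which activating it is not optimal. A bandit is indexable if $\lambda_1\le\lambda_2$ implies $\Omega(\lambda_1)\subseteq\Omega(\lambda_2)$; the restless bandit problem is indexable if all its bandits, the $M$ sources and the dummy bandits, are indexable. **Theorem.** The multi-action restless bandit problem with dummy bandits is indexable. Moreover: 1. For each source $m$ and each $\lambda$, $\Omega_m(\lambda)=\{(\delta,d): d>0\ \text{or}\ \gamma_m(\delta)<\bar p_{m,opt}(\lambda)\}$. 2. For each source $m$, $\bar p_{m,opt}$ is non-decreasing, and it is strictly increasing as long as it stays below $\ell_m$: if $\lambda_1<\lambda_2$ and $\bar p_{m,opt}(\lambda_1)<\ell_m$, then $\bar p_{m,opt}(\lambda_1)<\bar p_{m,opt}(\lambda_2)$. 3. If $p_m$ is bounded and $\bar p_{m,opt}(\lambda)<\ell_m$, then there is a policy with a constant buffer position ($b_{m,i}=b$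 for all $i\ge1$) that attains $\bar p_{m,opt}(\lambda)$ and that, in every slot $t\ge D_{m,0}$, is passive if and only if $(\Delta_m(t),d_m(t))\in\Omega_m(\lambda)$. 4. If $\lambda>0$, then $\Omega_0(\lambda)$ is the set of all states, and activating no dummy bandit in any slot minimizes $\limsup_n\frac1n\sum_{t<n}\lambda c_0(t)$ over the sequences $c_0(t)\in\{0,\dots,N\}$; if $\lambda\le0$, then $\Omega_0(\lambda)=\emptyset$, and activating all $N$ dummy bandits in every slot does. -/

import Mathlib

open MeasureTheory Filter

noncomputable section

/-- The data of one source together with its channel. -/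
structure Source where
  /-- the inference error `p(δ)` as a function of the age of information `δ` -/
  p : ℕ → ℝ
  /-- the weight `w` -/
  w : ℝ
  w_pos : 0 < w
  /-- the buffer size `B` -/
  B : ℕ
  B_pos : 0 < B
  /-- the common law of the i.i.d. transmission times `T_0, T_1, …` -/
  law : PMF ℕ
  /-- transmission times are at least one slot -/
  law_zero : law 0 = 0
  /-- transmission times have a finite mean -/
  law_mean : Integrable (fun n : ℕ => (n : ℝ)) law.toMeasure
  /-- the age of information at time `0` -/
  age₀ : ℕ
  /-- the buffer position of the feature that is submitted at time `S_0 = 0` -/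
  pos₀ : Fin B

/-- A causal scheduling policy for one source. A realization of the transmission times is a
sequence `T : ℕ → ℕ`. After the delivery of feature `i` the scheduler waits `wait i T` slots, and
then submits feature `i + 1` from the buffer position `pos i T`. Both decisions use only what has
been observed by then, namely `T 0, …, T i`. -/
structure Policy (B : ℕ) where
  wait : ℕ → (ℕ → ℕ) → ℕ
  pos : ℕ → (ℕ → ℕ) → Fin B
  wait_causal : ∀ i T T', (∀ j ≤ i, T j = T' j) → wait i T = wait i T'
  pos_causal : ∀ i T T', (∀ j ≤ i, T j = T' j) → pos i T = pos i T'

namespace Policy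

variable {B : ℕ}

/-- The submission time `S_i`. -/
def submit (π : Policy B) (T : ℕ → ℕ) : ℕ → ℕ
  | 0 => 0
  | i + 1 => submit π T i + T i + π.wait i T

/-- The delivery time `D_i = S_i + T_i`. -/
def deliver (π : Policy B) (T : ℕ → ℕ) (i : ℕ) : ℕ := π.submit T i + T i

/-- At slot `t` a feature is under service: `S_i ≤ t < D_i` for some `i`. -/
def Busy (π : Policy B) (T : ℕ → ℕ) (t : ℕ) : Prop :=
  ∃ i, π.submit T i ≤ t ∧ t < π.deliver T i

open Classical in
/-- The channel occupation indicator `c(t)`. -/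
def occ (π : Policy B) (T : ℕ → ℕ) (t : ℕ) : ℝ := if π.Busy T t then 1 else 0

/-- The time `d(t)` that has been spent by slot `t` on the feature under service, and `0` if
there is none. (The set below has at most one element.) -/
def elapsed (π : Policy B) (T : ℕ → ℕ) (t : ℕ) : ℕ :=
  sSup {a | ∃ i, π.submit T i ≤ t ∧ t < π.deliver T i ∧ a = t - π.submit T i}

/-- The bandit is passive at slot `t`: no feature `1, 2, …` is submitted at `t`. -/
def PassiveAt (π : Policy B) (T : ℕ → ℕ) (t : ℕ) : Prop := ∀ i, π.submit T (i + 1) ≠ t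

end Policy

namespace Source

variable (s : Source)

/-- The buffer position `b_i` of feature `i`. -/
def bufPos (π : Policy s.B) (T : ℕ → ℕ) : ℕ → Fin s.B
  | 0 => s.pos₀
  | i + 1 => π.pos i T

open Classical in
/-- The age of information `Δ(t) = t - max {S_i - b_i : D_i ≤ t}`, written as the minimum of
`t - S_i + b_i`; before the first delivery it grows linearly from its initial value. -/
def age (π : Policy s.B) (T : ℕ → ℕ) (t : ℕ) : ℕ :=
  if t < π.deliver T 0 then s.age₀ + t
  else sInf {a | ∃ i, π.deliver T i ≤ t ∧ a = t - π.submit T i + (s.bufPos π T i : ℕ)}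

/-- The law of the i.i.d. sequence of transmission times. -/
def seqLaw : Measure (ℕ → ℕ) := Measure.infinitePi (fun _ : ℕ => s.law.toMeasure)

/-- The long-run average cost
`limsup_n E[(1/n) ∑_{t<n} (w p(Δ(t)) + lam c(t))]` of a policy. -/
def avgCost (lam : ℝ) (π : Policy s.B) : EReal :=
  limsup (fun n : ℕ => (((∫ T, (1 / (n : ℝ)) *
    ∑ t ∈ Finset.range n, (s.w * s.p (s.age π T t) + lam * π.occ T t) ∂s.seqLaw : ℝ)) : EReal))
    atTop

/-- The optimal value of the single-source problem with transmission cost `lam`. -/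
def optVal (lam : ℝ) : EReal := ⨅ π : Policy s.B, s.avgCost lam π

/-- The index function `γ(δ) = inf_{τ ≥ 1} (1/τ) ∑_{k<τ} E[w p(δ + k + T)]`. -/
def gam (δ : ℕ) : EReal :=
  ⨅ τ : ℕ+, (((1 / ((τ : ℕ) : ℝ)) * ∑ k ∈ Finset.range (τ : ℕ),
    ∫ T : ℕ, s.w * s.p (δ + k + T) ∂s.law.toMeasure : ℝ) : EReal)

/-- The expected error cost `E[∑_{k < τ + T} w p(δ + k)]` up to the next delivery, for an idle
source of age `δ` that waits `τ` slots and then transmits. -/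
def cycleCost (δ τ : ℕ) : ℝ :=
  ∫ T : ℕ, (∑ k ∈ Finset.range (τ + T), s.w * s.p (δ + k)) ∂s.law.toMeasure

/-- Transmitting at once is optimal for an idle source of age `δ`: waiting time `0` attains the
minimum over waiting times `τ` and buffer positions `b` in the average-cost optimality equation
`h(δ) = inf_{τ, b} { E[∑_{k < τ+T} (w p(δ+k) - g)] + lam E[T] + E[h(T + b)] }`,
`g = optVal lam`. The terms that do not depend on `τ` cancel, and `E[∑_{k<τ+T} g] = τ g + E[T] g`,
so that the requirement is `cycleCost δ 0 ≤ cycleCost δ τ - τ g`, for all `τ`. -/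
def TransmitOptimal (lam : ℝ) (δ : ℕ) : Prop :=
  ∀ τ : ℕ, (s.cycleCost δ 0 : EReal) + (τ : EReal) * s.optVal lam ≤ (s.cycleCost δ τ : EReal)

/-- The passive set `Ω(lam)`: the states `(δ, d)` in which the optimal action is the passive one,
either because a feature is under service, or because transmitting at once is not optimal. -/
def passiveSet (lam : ℝ) : Set (ℕ × ℕ) := {x | 0 < x.2 ∨ ¬ s.TransmitOptimal lam x.1}

/-- `liminf_n (1/n) ∑_{k<n} w p(k)`, the average error cost of a source whose age
grows without bound. -/
def silentLevel : EReal :=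
  liminf (fun n : ℕ =>
    (((1 / (n : ℝ)) * ∑ k ∈ Finset.range n, s.w * s.p k : ℝ) : EReal)) atTop

/-- `π` is an optimal solution of the single-source problem. -/
def IsOptimalPolicy (lam : ℝ) (π : Policy s.B) : Prop := s.avgCost lam π = s.optVal lam

/-- From the initial delivery on, `π` takes the passive action exactly in the states of `Ω`,
on every realization of the transmission times. -/
def PassiveExactlyOn (π : Policy s.B) (Ω : Set (ℕ × ℕ)) : Prop :=
  ∀ T : ℕ → ℕ, (∀ i, 1 ≤ T i) → ∀ t, T 0 ≤ t →
    (π.PassiveAt T t ↔ (s.age π T t, π.elapsed T t) ∈ Ω)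

end Source

/-- The multi-action restless bandit problem: `M` sources, `N` channels, and `N` dummy bandits of
zero penalty, each of which occupies a channel in every slot in which it is activated. -/
structure RMAB where
  M : ℕ
  N : ℕ
  source : Fin M → Source

namespace RMAB

variable (R : RMAB)

/-- The long-run average cost of activating `c t` dummy bandits in slot `t`. -/
def dummyCost (lam : ℝ) (c : ℕ → Fin (R.N + 1)) : EReal :=
  limsup (fun n : ℕ =>
    (((1 / (n : ℝ)) * ∑ t ∈ Finset.range n, lam * ((c t : ℕ) : ℝ) : ℝ) : EReal)) atTop

/-- `c` is an optimal solution of the problem of the dummy bandits. -/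
def IsOptimalDummy (lam : ℝ) (c : ℕ → Fin (R.N + 1)) : Prop :=
  ∀ c', R.dummyCost lam c ≤ R.dummyCost lam c'

/-- The passive set of a dummy bandit: the states in which activating it (action `1`) does not
minimize the cost `lam * a` of the slot over the actions `a = 0, 1`. The actions of a dummy bandit
have no other effect, so that this does not depend on the state. -/
def dummyPassiveSet (lam : ℝ) : Set (ℕ × ℕ) :=
  {_x | ¬ ∀ a : Fin 2, lam * 1 ≤ lam * ((a : ℕ) : ℝ)}

/-- The passive sets of the bandits: `none` is the class of dummy bandits, `some m` is source `m`. -/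
def passiveSet : Option (Fin R.M) → ℝ → Set (ℕ × ℕ)
  | none => fun lam => dummyPassiveSet lam
  | some m => fun lam => (R.source m).passiveSet lam

/-- A bandit is indexable if its passive set increases with the transmission cost. -/
def BanditIndexable (k : Option (Fin R.M)) : Prop :=
  ∀ lam₁ lam₂ : ℝ, lam₁ ≤ lam₂ → R.passiveSet k lam₁ ⊆ R.passiveSet k lam₂

/-- The problem is indexable if all its bandits are. -/
def Indexable : Prop := ∀ k, R.BanditIndexable k

end RMAB

end

/-! ### Sums over consecutive blocks -/

/-! Indexability reduces to two facts. Waiting `τ` more slots adds `E[w p(δ + k + T)]` for `k < τ`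
to the error cost of a cycle, so transmitting at once is optimal exactly when the optimal value is
at most `γ(δ)` (`transmitOptimal_iff`). And the optimal value is monotone in the transmission cost,
which multiplies a nonnegative occupation time (`optVal_mono`). Hence the passive set is a sublevel
set of `γ` whose level rises with the cost.

Strictness below the silent level rests on `exists_meanAgeTotal_ge`: for any `L` below that level, a
policy pays at least `L` per slot up to a constant per transmission. If raising the cost did not
raise the optimum, near-optimal policies would transmit arbitrarily rarely, and would then pay about
`L`, which can be chosen above the optimum.

For the threshold policy, let `U(a)` be the cost relative to the optimal value `g` of an idle period
begun at age `a` and the transmission that ends it, when the source waits for `threshWait`. This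
wait minimizes over all waiting times (`waitValue_threshWait_le`). The total cost splits at the
deliveries, and independence of each transmission time from the past turns the expected relative
cost into a sum of terms `E[U(T + b)] + lam E[T]`, one per feature, up to boundary errors
(`meanAgeTotal_add_ge`). If all these terms were positive, no policy could come near `g`: frequent
transmission pays for each feature, rare transmission pays the silent level (`exists_pos_cycle_le`).
So some `b` makes the term nonpositive. The same estimate applied to the negated cost, where the
threshold policy gives equality, shows that this policy with this `b` costs at most `g`
(`avgCost_threshPolicy_le`). -/

theorem sum_Ico_blocks (φ : ℕ → ℝ) {u : ℕ → ℕ} (hu : Monotone u) (m : ℕ) :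
    ∑ t ∈ Finset.Ico (u 0) (u m), φ t =
      ∑ i ∈ Finset.range m, ∑ t ∈ Finset.Ico (u i) (u (i + 1)), φ t := by
  induction m with
  | zero => simp
  | succ m ih =>
    rw [Finset.sum_range_succ, ← ih,
      Finset.sum_Ico_consecutive _ (hu (Nat.zero_le m)) (hu (Nat.le_succ m))]

theorem sum_range_blocks (φ : ℕ → ℝ) {e : ℕ → ℕ} (he : Monotone e) {n m : ℕ} (hn : n ≤ e m) :
    ∑ t ∈ Finset.range n, φ t = ∑ t ∈ Finset.range (min n (e 0)), φ t +
      ∑ i ∈ Finset.range m, ∑ t ∈ Finset.Ico (min n (e i)) (min n (e (i + 1))), φ t := by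
  have h := sum_Ico_blocks φ (u := fun i => min n (e i))
    (fun i j hij => min_le_min le_rfl (he hij)) m
  simp only [min_eq_left hn] at h
  rw [← h, Finset.range_eq_Ico, Finset.range_eq_Ico,
    Finset.sum_Ico_consecutive _ (Nat.zero_le _) (min_le_left _ _)]

/-! ### Submission, delivery and occupation times along a path. -/

namespace Policy

variable {B : ℕ} (π : Policy B) {T : ℕ → ℕ}

theorem submit_succ (T : ℕ → ℕ) (i : ℕ) :
    π.submit T (i + 1) = π.deliver T i + π.wait i T := rfl

theorem submit_lt_deliver (hT : ∀ i, 1 ≤ T i) (i : ℕ) : π.submit T i < π.deliver T i := by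
  have := hT i
  unfold deliver
  omega

theorem deliver_le_submit (T : ℕ → ℕ) (i : ℕ) : π.deliver T i ≤ π.submit T (i + 1) :=
  Nat.le_add_right _ _

theorem submit_strictMono (hT : ∀ i, 1 ≤ T i) : StrictMono (π.submit T) :=
  strictMono_nat_of_lt_succ fun i =>
    (π.submit_lt_deliver hT i).trans_le (π.deliver_le_submit T i)

theorem deliver_strictMono (hT : ∀ i, 1 ≤ T i) : StrictMono (π.deliver T) :=
  strictMono_nat_of_lt_succ fun i =>
    (π.deliver_le_submit T i).trans_lt (π.submit_lt_deliver hT (i + 1))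

theorem le_submit (hT : ∀ i, 1 ≤ T i) (i : ℕ) : i ≤ π.submit T i :=
  (π.submit_strictMono hT).id_le i

theorem le_deliver (hT : ∀ i, 1 ≤ T i) (i : ℕ) : i ≤ π.deliver T i :=
  (π.deliver_strictMono hT).id_le i

theorem deliver_zero (T : ℕ → ℕ) : π.deliver T 0 = T 0 := by simp [deliver, submit]

theorem submit_congr {T T' : ℕ → ℕ} {i : ℕ} (h : ∀ j < i, T j = T' j) :
    π.submit T i = π.submit T' i := by
  induction i with
  | zero => rfl
  | succ i ih =>
    simp only [submit]
    rw [ih fun j hj => h j (by omega), h i (by omega),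
      π.wait_causal i T T' fun j hj => h j (by omega)]

/-- In the interval from the submission of feature `i` to that of feature `i + 1`, the source is
busy exactly until the delivery of feature `i`. -/
theorem busy_iff (hT : ∀ i, 1 ≤ T i) {i t : ℕ} (h₁ : π.submit T i ≤ t)
    (h₂ : t < π.submit T (i + 1)) : π.Busy T t ↔ t < π.deliver T i := by
  refine ⟨?_, fun h => ⟨i, h₁, h⟩⟩
  rintro ⟨j, hj₁, hj₂⟩
  rcases lt_trichotomy i j with h | rfl | h
  · have := (π.submit_strictMono hT).monotone (show i + 1 ≤ j from h)
    omega
  · exact hj₂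
  · have := (π.deliver_strictMono hT).monotone h.le
    have := π.deliver_le_submit T j
    have := (π.submit_strictMono hT).monotone (show j + 1 ≤ i from h)
    omega

/-- The number of slots before `n` in which a feature is under service, as a sum over the
features. -/
noncomputable def occTotal (n : ℕ) (T : ℕ → ℕ) : ℝ :=
  ∑ i ∈ Finset.range n, ((min n (π.deliver T i) - min n (π.submit T i) : ℕ) : ℝ)

theorem sum_occ (hT : ∀ i, 1 ≤ T i) (n : ℕ) :
    ∑ t ∈ Finset.range n, π.occ T t = π.occTotal n T := by
  rw [sum_range_blocks _ (π.submit_strictMono hT).monotone (π.le_submit hT n)]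
  have h0 : π.submit T 0 = 0 := rfl
  simp only [h0, Nat.min_zero, Finset.range_zero, Finset.sum_empty, zero_add, occTotal]
  refine Finset.sum_congr rfl fun i _ => ?_
  have hd := π.submit_lt_deliver hT i
  have hs := π.deliver_le_submit T i
  rw [← Finset.sum_Ico_consecutive _ (min_le_min le_rfl hd.le : min n _ ≤ min n _)
    (min_le_min le_rfl hs)]
  have e₁ : ∀ t ∈ Finset.Ico (min n (π.submit T i)) (min n (π.deliver T i)), π.occ T t = 1 := by
    intro t ht
    rw [Finset.mem_Ico] at ht
    have : π.Busy T t := ⟨i, by omega, by omega⟩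
    simp [occ, this]
  have e₂ : ∀ t ∈ Finset.Ico (min n (π.deliver T i)) (min n (π.submit T (i + 1))),
      π.occ T t = 0 := by
    intro t ht
    rw [Finset.mem_Ico] at ht
    have : ¬ π.Busy T t := by
      rw [π.busy_iff hT (i := i) (by omega) (by omega)]
      omega
    simp [occ, this]
  rw [Finset.sum_congr rfl e₁, Finset.sum_congr rfl e₂]
  simp

theorem occ_le_one (T : ℕ → ℕ) (t : ℕ) : π.occ T t ≤ 1 := by
  unfold occ; split_ifs <;> norm_num

theorem elapsed_eq (hT : ∀ i, 1 ≤ T i) {i t : ℕ} (h₁ : π.submit T i ≤ t)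
    (h₂ : t < π.deliver T i) : π.elapsed T t = t - π.submit T i := by
  have : {a | ∃ i, π.submit T i ≤ t ∧ t < π.deliver T i ∧ a = t - π.submit T i} =
      {t - π.submit T i} := by
    ext a
    simp only [Set.mem_ofPred_eq, Set.mem_singleton_iff]
    refine ⟨?_, fun h => ⟨i, h₁, h₂, h⟩⟩
    rintro ⟨j, hj₁, hj₂, rfl⟩
    rcases lt_trichotomy i j with h | rfl | h
    · have := (π.submit_strictMono hT).monotone (show i + 1 ≤ j from h)
      have := π.deliver_le_submit T i
      omega
    · rfl
    · have := π.deliver_le_submit T j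
      have := (π.submit_strictMono hT).monotone (show j + 1 ≤ i from h)
      omega
  simp [elapsed, this]

/-- The indicator that feature `i` is submitted before slot `n`. -/
noncomputable def started (n : ℕ) (T : ℕ → ℕ) (i : ℕ) : ℝ := if π.submit T i < n then 1 else 0

theorem started_nonneg (n : ℕ) (T : ℕ → ℕ) (i : ℕ) : 0 ≤ π.started n T i := by
  unfold started; split_ifs <;> norm_num

theorem started_le_one (n : ℕ) (T : ℕ → ℕ) (i : ℕ) : π.started n T i ≤ 1 := by
  unfold started; split_ifs <;> norm_num

theorem started_congr (n : ℕ) {T T' : ℕ → ℕ} {i : ℕ} (h : ∀ j < i, T j = T' j) :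
    π.started n T i = π.started n T' i := by
  simp only [started, π.submit_congr h]

theorem started_anti (hT : ∀ i, 1 ≤ T i) (n i : ℕ) :
    π.started n T (i + 1) ≤ π.started n T i := by
  have := π.submit_strictMono hT (Nat.lt_add_one i)
  unfold started
  split_ifs <;> first | omega | norm_num

theorem started_eq_zero (hT : ∀ i, 1 ≤ T i) {n i : ℕ} (h : n ≤ i) : π.started n T i = 0 := by
  have := π.le_submit hT i
  rw [started, if_neg (by omega)]

theorem sum_started_sub_le_one (n m : ℕ) (T : ℕ → ℕ) :
    ∑ i ∈ Finset.range m, (π.started n T i - π.started n T (i + 1)) ≤ 1 := by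
  rw [Finset.sum_range_sub']
  linarith [π.started_nonneg n T m, π.started_le_one n T 0]

/-- The sum of a nonnegative function of the transmission times over the features that are
submitted before `n` but whose successor is not. There is at most one such feature. -/
theorem sum_last_le (hT : ∀ i, 1 ≤ T i) (n m : ℕ) (R : ℝ) (hR : 0 ≤ R) :
    ∑ i ∈ Finset.range m, (π.started n T i - π.started n T (i + 1)) * (1 + (T i : ℝ)) ≤
      R + ∑ i ∈ Finset.range m, π.started n T i * (if R < 1 + (T i : ℝ) then 1 + (T i : ℝ) else 0)
      := by
  have h : ∀ i ∈ Finset.range m, (π.started n T i - π.started n T (i + 1)) * (1 + (T i : ℝ)) ≤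
      (π.started n T i - π.started n T (i + 1)) * R +
        π.started n T i * (if R < 1 + (T i : ℝ) then 1 + (T i : ℝ) else 0) := by
    intro i _
    have h1 := π.started_anti hT n i
    have h2 := π.started_nonneg n T (i + 1)
    have h3 : (0 : ℝ) ≤ T i := Nat.cast_nonneg _
    split_ifs with hlt
    · nlinarith [mul_nonneg h2 h3, mul_nonneg (sub_nonneg.2 h1) hR]
    · nlinarith [mul_nonneg (sub_nonneg.2 h1) (sub_nonneg.2 (not_lt.1 hlt))]
  refine (Finset.sum_le_sum h).trans ?_
  rw [Finset.sum_add_distrib, ← Finset.sum_mul]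
  nlinarith [π.sum_started_sub_le_one n m T]

/-- The number of features that are submitted before slot `n`. -/
noncomputable def count (n : ℕ) (T : ℕ → ℕ) : ℝ := ∑ i ∈ Finset.range n, π.started n T i

theorem count_nonneg (n : ℕ) (T : ℕ → ℕ) : 0 ≤ π.count n T :=
  Finset.sum_nonneg fun i _ => π.started_nonneg n T i

theorem count_le_occTotal (hT : ∀ i, 1 ≤ T i) (n : ℕ) : π.count n T ≤ π.occTotal n T := by
  refine Finset.sum_le_sum fun i _ => ?_
  have := π.submit_lt_deliver hT i
  unfold started
  split_ifs
  · have : 1 ≤ min n (π.deliver T i) - min n (π.submit T i) := by omega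
    exact_mod_cast this
  · positivity

/-- Cutting at slot `n` shortens the service of feature `i` only if feature `i + 1` is not submitted
before `n`. At most one submitted feature is of this kind, and the difference of the `started`
indicators singles it out. -/
theorem abs_occTotal_sub_le (hT : ∀ i, 1 ≤ T i) (n : ℕ) :
    |π.occTotal n T - ∑ i ∈ Finset.range n, π.started n T i * (T i : ℝ)| ≤
      ∑ i ∈ Finset.range n, (π.started n T i - π.started n T (i + 1)) * (1 + (T i : ℝ)) := by
  rw [occTotal, ← Finset.sum_sub_distrib]
  refine (Finset.abs_sum_le_sum_abs _ _).trans (Finset.sum_le_sum fun i _ => ?_)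
  have h1 := π.submit_lt_deliver hT i
  have h2 := π.deliver_le_submit T i
  have h3 : π.deliver T i = π.submit T i + T i := rfl
  have h4 : (0 : ℝ) ≤ T i := Nat.cast_nonneg _
  unfold started
  split_ifs with ha hb hb
  · have : min n (π.deliver T i) - min n (π.submit T i) = T i := by omega
    simp [this]
  · have : min n (π.deliver T i) - min n (π.submit T i) ≤ T i := by omega
    have h5 : ((min n (π.deliver T i) - min n (π.submit T i) : ℕ) : ℝ) ≤ T i := by exact_mod_cast this
    have h6 : (0 : ℝ) ≤ ((min n (π.deliver T i) - min n (π.submit T i) : ℕ) : ℝ) := Nat.cast_nonneg _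
    rw [abs_le]
    constructor <;> linarith
  · omega
  · have : min n (π.deliver T i) - min n (π.submit T i) = 0 := by omega
    simp [this]

end Policy

/-! ### The age of information along a path. -/

namespace Source

variable (s : Source) (π : Policy s.B) {T : ℕ → ℕ}

/-- The amount by which the age at the delivery of feature `i` exceeds its transmission time. It is
the buffer position, unless an earlier feature is fresher. -/
def effPos (T : ℕ → ℕ) : ℕ → ℕ
  | 0 => s.pos₀
  | i + 1 => min (π.pos i T) (T i + effPos T i + π.wait i T)

/-- The age at the delivery of feature `i`. -/
def delAge (T : ℕ → ℕ) (i : ℕ) : ℕ := T i + s.effPos π T i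

/-- The age at the submission of feature `i`. -/
def subAge (T : ℕ → ℕ) : ℕ → ℕ
  | 0 => s.age₀
  | i + 1 => s.delAge π T i + π.wait i T

theorem effPos_lt (T : ℕ → ℕ) (i : ℕ) : s.effPos π T i < s.B := by
  cases i with
  | zero => exact s.pos₀.2
  | succ i => exact (min_le_left _ _).trans_lt (π.pos i T).2

theorem effPos_congr {T T' : ℕ → ℕ} {i : ℕ} (h : ∀ j < i, T j = T' j) :
    s.effPos π T i = s.effPos π T' i := by
  induction i with
  | zero => rfl
  | succ i ih =>
    simp only [effPos]
    rw [ih fun j hj => h j (by omega), h i (by omega),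
      π.wait_causal i T T' fun j hj => h j (by omega),
      π.pos_causal i T T' fun j hj => h j (by omega)]

theorem delAge_congr {T T' : ℕ → ℕ} {i : ℕ} (h : ∀ j < i + 1, T j = T' j) :
    s.delAge π T i = s.delAge π T' i := by
  simp only [delAge]
  rw [s.effPos_congr π fun j hj => h j (by omega), h i (by omega)]

theorem subAge_congr {T T' : ℕ → ℕ} {i : ℕ} (h : ∀ j < i, T j = T' j) :
    s.subAge π T i = s.subAge π T' i := by
  cases i with
  | zero => rfl
  | succ i =>
    simp only [subAge]
    rw [s.delAge_congr π h, π.wait_causal i T T' fun j hj => h j (by omega)]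

/-- All candidates `t - S_j + b_j` grow at slope one, so their order never changes. At each delivery
it suffices to compare the new candidate with the previous minimum, and this is the minimum in the
recursion of `effPos`. -/
theorem delAge_isLeast (hT : ∀ i, 1 ≤ T i) (i : ℕ) {t : ℕ} (ht : π.deliver T i ≤ t) :
    (∀ j ≤ i, s.delAge π T i + (t - π.deliver T i) ≤ t - π.submit T j + s.bufPos π T j) ∧
      ∃ j ≤ i, s.delAge π T i + (t - π.deliver T i) = t - π.submit T j + s.bufPos π T j := by
  induction i with
  | zero =>
    have h : s.delAge π T 0 + (t - π.deliver T 0) = t - π.submit T 0 + s.bufPos π T 0 := by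
      simp only [delAge, effPos, bufPos, Policy.deliver, Policy.submit] at ht ⊢
      omega
    refine ⟨fun j hj => ?_, 0, le_rfl, h⟩
    rw [Nat.le_zero.1 hj]
    exact h.le
  | succ i ih =>
    have h1 := π.deliver_strictMono hT (Nat.lt_add_one i)
    obtain ⟨ih1, k, hk, ih2⟩ := ih (by omega)
    have e1 : π.deliver T (i + 1) = π.submit T (i + 1) + T (i + 1) := rfl
    have e2 : π.submit T (i + 1) = π.deliver T i + π.wait i T := rfl
    have e3 : s.delAge π T (i + 1) = T (i + 1) +
      min (s.bufPos π T (i + 1) : ℕ) (s.delAge π T i + π.wait i T) := rfl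
    constructor
    · intro j hj
      rcases Nat.lt_or_ge i j with h | h
      · obtain rfl : j = i + 1 := by omega
        omega
      · have := ih1 j h
        omega
    · rcases le_total (s.bufPos π T (i + 1) : ℕ) (s.delAge π T i + π.wait i T) with h | h
      · refine ⟨i + 1, le_rfl, ?_⟩
        rw [min_eq_left h] at e3
        omega
      · refine ⟨k, by omega, ?_⟩
        rw [min_eq_right h] at e3
        omega

theorem age_eq (hT : ∀ i, 1 ≤ T i) {i t : ℕ} (h₁ : π.deliver T i ≤ t)
    (h₂ : t < π.deliver T (i + 1)) :
    s.age π T t = s.delAge π T i + (t - π.deliver T i) := by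
  have h0 := (π.deliver_strictMono hT).monotone (Nat.zero_le i)
  rw [age, if_neg (by omega)]
  obtain ⟨ha, j, hj, hb⟩ := s.delAge_isLeast π hT i h₁
  refine IsLeast.csInf_eq ⟨⟨j, ((π.deliver_strictMono hT).monotone hj).trans h₁, hb⟩, ?_⟩
  rintro a ⟨k, hk, rfl⟩
  refine ha k ?_
  by_contra hlt
  have := (π.deliver_strictMono hT).monotone (show i + 1 ≤ k by omega)
  omega

/-- The total of `φ (age t)` over the slots `t < n`, as a sum over the delivered features. -/
noncomputable def ageTotal (φ : ℕ → ℝ) (n : ℕ) (T : ℕ → ℕ) : ℝ :=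
  ∑ k ∈ Finset.range (min n (π.deliver T 0)), φ (s.age₀ + k) +
    ∑ i ∈ Finset.range n,
      ∑ k ∈ Finset.range (min n (π.deliver T (i + 1)) - min n (π.deliver T i)),
        φ (s.delAge π T i + k)

theorem sum_age (hT : ∀ i, 1 ≤ T i) (φ : ℕ → ℝ) (n : ℕ) :
    ∑ t ∈ Finset.range n, φ (s.age π T t) = s.ageTotal π φ n T := by
  rw [sum_range_blocks _ (π.deliver_strictMono hT).monotone (π.le_deliver hT n), ageTotal]
  congr 1
  · refine Finset.sum_congr rfl fun t ht => ?_
    rw [Finset.mem_range] at ht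
    rw [age, if_pos (by omega)]
  · refine Finset.sum_congr rfl fun i _ => ?_
    rw [Finset.sum_Ico_eq_sum_range]
    refine Finset.sum_congr rfl fun k hk => ?_
    rw [Finset.mem_range] at hk
    rw [s.age_eq π hT (i := i) (by omega) (by omega)]
    congr 2
    omega

end Source

/-! ### Independence, integrability and expected totals. -/

theorem measurable_of_causal {α : Type*} [MeasurableSpace α] (i : ℕ) (g : (ℕ → ℕ) → α)
    (hg : ∀ T T', (∀ j < i, T j = T' j) → g T = g T') : Measurable g := by
  let ext : (Finset.range i → ℕ) → ℕ → ℕ := fun x j =>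
    if h : j ∈ Finset.range i then x ⟨j, h⟩ else 0
  have : g = (fun x => g (ext x)) ∘ (Finset.range i).restrict := by
    funext T
    refine hg _ _ fun j hj => ?_
    simp [ext, hj]
  rw [this]
  exact (measurable_of_countable _).comp (Finset.measurable_restrict _)

namespace Source

variable (s : Source)

instance : IsProbabilityMeasure s.seqLaw := by unfold seqLaw; infer_instance

theorem ae_law : ∀ᵐ t ∂s.law.toMeasure, 1 ≤ t := by
  rw [ae_iff, show {t : ℕ | ¬ 1 ≤ t} = {0} by ext t; simp,
    PMF.toMeasure_apply_singleton _ _ (measurableSet_singleton _), s.law_zero]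

theorem ae_seqLaw : ∀ᵐ T ∂s.seqLaw, ∀ i, 1 ≤ T i := by
  rw [ae_all_iff]
  intro i
  exact (measurePreserving_eval_infinitePi (fun _ : ℕ => s.law.toMeasure) i).quasiMeasurePreserving.ae
    s.ae_law

/-- Resampling one coordinate of a product law from an independent copy leaves the law unchanged.
Combined with Fubini, this expresses the independence of `T i` from the past without conditional
expectations. -/
theorem measurePreserving_update (i : ℕ) :
    MeasurePreserving (fun x : (ℕ → ℕ) × ℕ => Function.update x.1 i x.2)
      (s.seqLaw.prod s.law.toMeasure) s.seqLaw := by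
  have hm : Measurable (fun x : (ℕ → ℕ) × ℕ => Function.update x.1 i x.2) := measurable_update'
  refine ⟨hm, Measure.eq_infinitePi _ fun I t ht => ?_⟩
  have hpre : (fun x : (ℕ → ℕ) × ℕ => Function.update x.1 i x.2) ⁻¹' (Set.pi I t) =
      (Set.pi (I.erase i : Finset ℕ) t) ×ˢ (if i ∈ I then t i else Set.univ) := by
    ext ⟨T, a⟩
    simp only [Set.mem_preimage, Set.mem_pi, Set.mem_prod, Finset.coe_erase, Set.mem_sdiff,
      Finset.mem_coe, Set.mem_singleton_iff]
    constructor
    · intro h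
      refine ⟨fun j hj => by simpa [hj.2] using h j hj.1, ?_⟩
      split_ifs with hi
      · simpa using h i hi
      · trivial
    · rintro ⟨h₁, h₂⟩ j hj
      rcases eq_or_ne j i with rfl | hji
      · simpa [hj] using h₂
      · simpa [hji] using h₁ j ⟨hj, hji⟩
  rw [Measure.map_apply hm (.pi I.countable_toSet fun j _ => ht j), hpre, Measure.prod_prod, seqLaw,
    Measure.infinitePi_pi _ fun j _ => ht j]
  split_ifs with hi
  · rw [Finset.prod_erase_mul _ _ hi]
  · rw [Finset.erase_eq_of_notMem hi, measure_univ, mul_one]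

variable {s}

theorem integrable_eval_of_causal {i : ℕ} {H : (ℕ → ℕ) → ℕ → ℝ}
    (hH : ∀ T T' t, (∀ j < i, T j = T' j) → H T t = H T' t) {F : ℕ → ℝ}
    (hF : Integrable F s.law.toMeasure) (hb : ∀ T t, |H T t| ≤ F t) :
    Integrable (fun x : (ℕ → ℕ) × ℕ => H x.1 x.2) (s.seqLaw.prod s.law.toMeasure) ∧
    Integrable (fun T => H T (T i)) s.seqLaw := by
  have hm : Measurable (fun T : ℕ → ℕ => H T (T i)) := by
    refine measurable_of_causal (i + 1) _ fun T T' h => ?_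
    rw [hH T T' _ fun j hj => h j (by omega), h i (by omega)]
  have hcomp : (fun T => H T (T i)) ∘ (fun x : (ℕ → ℕ) × ℕ => Function.update x.1 i x.2) =
      fun x : (ℕ → ℕ) × ℕ => H x.1 x.2 := by
    funext x
    simp only [Function.comp, Function.update_self]
    exact hH _ _ _ fun j hj => by simp [hj.ne]
  have hint : Integrable (fun x : (ℕ → ℕ) × ℕ => H x.1 x.2) (s.seqLaw.prod s.law.toMeasure) := by
    refine (hF.comp_snd s.seqLaw).mono' ?_ (Eventually.of_forall fun x => hb _ _)
    rw [← hcomp]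
    exact (hm.comp (s.measurePreserving_update i).measurable).aestronglyMeasurable
  refine ⟨hint, ?_⟩
  rw [← hcomp] at hint
  exact ((s.measurePreserving_update i).integrable_comp hm.aestronglyMeasurable).1 hint

/-- Averaging over the transmission time `T i`, which is independent of `T 0, …, T (i - 1)`. -/
theorem integral_eval_of_causal {i : ℕ} {H : (ℕ → ℕ) → ℕ → ℝ}
    (hH : ∀ T T' t, (∀ j < i, T j = T' j) → H T t = H T' t) {F : ℕ → ℝ}
    (hF : Integrable F s.law.toMeasure) (hb : ∀ T t, |H T t| ≤ F t) :
    ∫ T, H T (T i) ∂s.seqLaw = ∫ T, (∫ t, H T t ∂s.law.toMeasure) ∂s.seqLaw := by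
  have hint := integrable_eval_of_causal hH hF hb
  rw [← integral_prod _ hint.1]
  have hm : AEStronglyMeasurable (fun T => H T (T i))
      ((s.seqLaw.prod s.law.toMeasure).map
        (fun x : (ℕ → ℕ) × ℕ => Function.update x.1 i x.2)) := by
    rw [(s.measurePreserving_update i).map_eq]
    exact hint.2.aestronglyMeasurable
  conv_lhs => rw [← (s.measurePreserving_update i).map_eq]
  rw [integral_map (s.measurePreserving_update i).measurable.aemeasurable hm]
  refine integral_congr_ae (Eventually.of_forall fun x => ?_)
  simp only [Function.update_self]
  exact hH _ _ _ fun j hj => by simp [hj.ne]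

theorem integrable_eval {F : ℕ → ℝ} (hF : Integrable F s.law.toMeasure) (i : ℕ) :
    Integrable (fun T : ℕ → ℕ => F (T i)) s.seqLaw :=
  (integrable_eval_of_causal (H := fun _ t => F t) (fun _ _ _ _ => rfl) hF.abs
    fun _ _ => le_rfl).2

theorem integrable_started (π : Policy s.B) (n i : ℕ) :
    Integrable (fun T => π.started n T i) s.seqLaw := by
  refine Integrable.of_bound (C := 1)
    (measurable_of_causal i _ fun T T' h => π.started_congr n h).aestronglyMeasurable
    (Eventually.of_forall fun T => ?_)
  rw [Real.norm_eq_abs, abs_of_nonneg (π.started_nonneg n T i)]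
  exact π.started_le_one n T i

theorem integrable_count (π : Policy s.B) (n : ℕ) : Integrable (π.count n) s.seqLaw :=
  integrable_finsetSum _ fun i _ => integrable_started π n i

/-- A reward that depends on the age offset and on the transmission time of a feature, summed over
the features that are submitted before slot `n`, if the mean reward is always at least `c`. -/
theorem le_integral_sum_started (π : Policy s.B) (n : ℕ) (G : ℕ → ℕ → ℝ) {F : ℕ → ℝ}
    (hF : Integrable F s.law.toMeasure) (hb : ∀ b < s.B, ∀ t, |G b t| ≤ F t) {c : ℝ}
    (hc : ∀ b < s.B, c ≤ ∫ t, G b t ∂s.law.toMeasure) :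
    Integrable (fun T => ∑ i ∈ Finset.range n, π.started n T i * G (s.effPos π T i) (T i))
      s.seqLaw ∧
    c * ∫ T, π.count n T ∂s.seqLaw ≤
      ∫ T, ∑ i ∈ Finset.range n, π.started n T i * G (s.effPos π T i) (T i) ∂s.seqLaw := by
  have hH : ∀ i, ∀ T T' t, (∀ j < i, T j = T' j) →
      π.started n T i * G (s.effPos π T i) t = π.started n T' i * G (s.effPos π T' i) t := by
    intro i T T' t h
    rw [π.started_congr n h, s.effPos_congr π h]
  have hbd : ∀ i T t, |π.started n T i * G (s.effPos π T i) t| ≤ F t := by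
    intro i T t
    rw [abs_mul, abs_of_nonneg (π.started_nonneg n T i)]
    exact (mul_le_of_le_one_left (abs_nonneg _) (π.started_le_one n T i)).trans
      (hb _ (s.effPos_lt π T i) t)
  have hI : ∀ i, Integrable (fun T => π.started n T i * G (s.effPos π T i) (T i)) s.seqLaw :=
    fun i => (integrable_eval_of_causal (hH i) hF (hbd i)).2
  refine ⟨integrable_finsetSum _ fun i _ => hI i, ?_⟩
  unfold Policy.count
  rw [integral_finsetSum _ fun i _ => hI i,
    integral_finsetSum _ fun i _ => integrable_started π n i, Finset.mul_sum]
  refine Finset.sum_le_sum fun i _ => ?_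
  -- Whether feature `i` is started, and its age offset, are decided by the transmission times
  -- before `i`. Averaging over `T i` first therefore gives at least `c` for each started feature,
  -- as in Wald's identity.
  rw [integral_eval_of_causal (hH i) hF (hbd i), ← integral_const_mul]
  refine integral_mono ((integrable_started π n i).const_mul c)
    (integrable_eval_of_causal (hH i) hF (hbd i)).1.integral_prod_left fun T => ?_
  simp only [integral_const_mul]
  rw [mul_comm]
  exact mul_le_mul_of_nonneg_left (hc _ (s.effPos_lt π T i)) (π.started_nonneg n T i)

variable (s)

theorem ageTotal_congr (π : Policy s.B) (φ : ℕ → ℝ) (n : ℕ) {T T' : ℕ → ℕ}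
    (h : ∀ j < n + 1, T j = T' j) : s.ageTotal π φ n T = s.ageTotal π φ n T' := by
  have hd : ∀ i < n + 1, π.deliver T i = π.deliver T' i := fun i hi => by
    rw [Policy.deliver, Policy.deliver, π.submit_congr fun j hj => h j (by omega), h i hi]
  unfold ageTotal
  congr 1
  · rw [hd 0 (by omega)]
  · refine Finset.sum_congr rfl fun i hi => ?_
    rw [Finset.mem_range] at hi
    rw [hd i (by omega), hd (i + 1) (by omega), s.delAge_congr π fun j hj => h j (by omega)]

/-- Ages before slot `n` stay below a deterministic level, so only finitely many values of `φ`
occur. This makes finite-horizon costs integrable with no growth condition on the penalty. -/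
theorem abs_ageTotal_le (π : Policy s.B) (φ : ℕ → ℝ) (n : ℕ) {T : ℕ → ℕ} (hT : ∀ i, 1 ≤ T i) :
    |s.ageTotal π φ n T| ≤ n * ∑ k ∈ Finset.range (s.age₀ + 2 * n + s.B), |φ k| := by
  rw [← s.sum_age π hT]
  refine (Finset.abs_sum_le_sum_abs _ _).trans ?_
  rw [← nsmul_eq_mul, ← Finset.card_range n, ← Finset.sum_const, Finset.card_range]
  refine Finset.sum_le_sum fun t ht => ?_
  refine Finset.single_le_sum (f := fun k => |φ k|) (fun _ _ => abs_nonneg _) ?_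
  rw [Finset.mem_range] at ht ⊢
  have hB := s.B_pos
  rw [age]
  split_ifs with h
  · omega
  · have : sInf {a | ∃ i, π.deliver T i ≤ t ∧ a = t - π.submit T i + (s.bufPos π T i : ℕ)} ≤
        t - π.submit T 0 + (s.bufPos π T 0 : ℕ) := Nat.sInf_le ⟨0, by omega, rfl⟩
    have := (s.bufPos π T 0).2
    omega

theorem integrable_ageTotal (π : Policy s.B) (φ : ℕ → ℝ) (n : ℕ) :
    Integrable (s.ageTotal π φ n) s.seqLaw := by
  refine Integrable.of_bound
    (measurable_of_causal (n + 1) _ fun T T' h => s.ageTotal_congr π φ n h).aestronglyMeasurable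
    (n * ∑ k ∈ Finset.range (s.age₀ + 2 * n + s.B), |φ k|) ?_
  filter_upwards [s.ae_seqLaw] with T hT
  exact s.abs_ageTotal_le π φ n hT

theorem occTotal_nonneg {B : ℕ} (π : Policy B) (n : ℕ) (T : ℕ → ℕ) : 0 ≤ π.occTotal n T :=
  Finset.sum_nonneg fun _ _ => Nat.cast_nonneg _

theorem occTotal_le {B : ℕ} (π : Policy B) (n : ℕ) {T : ℕ → ℕ} (hT : ∀ i, 1 ≤ T i) :
    π.occTotal n T ≤ n := by
  rw [← π.sum_occ hT]
  refine (Finset.sum_le_sum fun t _ => π.occ_le_one T t).trans ?_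
  simp

theorem integrable_occTotal (π : Policy s.B) (n : ℕ) : Integrable (π.occTotal n) s.seqLaw := by
  refine Integrable.of_bound
    (measurable_of_causal (n + 1) _ fun T T' h => ?_).aestronglyMeasurable n ?_
  · unfold Policy.occTotal
    refine Finset.sum_congr rfl fun i hi => ?_
    rw [Finset.mem_range] at hi
    rw [Policy.deliver, Policy.deliver, π.submit_congr fun j hj => h j (by omega),
      h i (by omega)]
  · filter_upwards [s.ae_seqLaw] with T hT
    rw [Real.norm_eq_abs, abs_of_nonneg (occTotal_nonneg π n T)]
    exact occTotal_le π n hT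

/-- The expected total of `φ (age t)` over the slots `t < n`. -/
noncomputable def meanAgeTotal (π : Policy s.B) (φ : ℕ → ℝ) (n : ℕ) : ℝ :=
  ∫ T, s.ageTotal π φ n T ∂s.seqLaw

/-- The expected number of slots before `n` in which a feature is under service. -/
noncomputable def meanOcc (π : Policy s.B) (n : ℕ) : ℝ := ∫ T, π.occTotal n T ∂s.seqLaw

/-- The expected number of features that are submitted before slot `n`. -/
noncomputable def meanCount (π : Policy s.B) (n : ℕ) : ℝ := ∫ T, π.count n T ∂s.seqLaw

/-- The expected cost per slot over the slots `t < n`. -/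
noncomputable def meanCost (lam : ℝ) (π : Policy s.B) (n : ℕ) : ℝ :=
  1 / (n : ℝ) * (s.meanAgeTotal π (fun k => s.w * s.p k) n + lam * s.meanOcc π n)

theorem avgCost_eq (lam : ℝ) (π : Policy s.B) :
    s.avgCost lam π = limsup (fun n => ((s.meanCost lam π n : ℝ) : EReal)) atTop := by
  unfold avgCost
  congr 1
  funext n
  congr 1
  rw [integral_const_mul, meanCost, meanAgeTotal, meanOcc, ← integral_const_mul lam,
    ← integral_add (s.integrable_ageTotal π _ n) ((s.integrable_occTotal π n).const_mul lam)]
  congr 1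
  refine integral_congr_ae ?_
  filter_upwards [s.ae_seqLaw] with T hT
  rw [Finset.sum_add_distrib, ← Finset.mul_sum _ _ lam, π.sum_occ hT,
    ← s.sum_age π hT (fun k => s.w * s.p k)]

theorem meanCount_nonneg (π : Policy s.B) (n : ℕ) : 0 ≤ s.meanCount π n :=
  integral_nonneg fun T => π.count_nonneg n T

theorem meanCount_le_meanOcc (π : Policy s.B) (n : ℕ) : s.meanCount π n ≤ s.meanOcc π n := by
  refine integral_mono_ae (integrable_count π n) (s.integrable_occTotal π n) ?_
  filter_upwards [s.ae_seqLaw] with T hT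
  exact π.count_le_occTotal hT n

theorem meanOcc_nonneg (π : Policy s.B) (n : ℕ) : 0 ≤ s.meanOcc π n :=
  integral_nonneg fun T => occTotal_nonneg π n T

theorem meanOcc_le (π : Policy s.B) (n : ℕ) : s.meanOcc π n ≤ n := by
  have h : s.meanOcc π n ≤ ∫ _, (n : ℝ) ∂s.seqLaw := by
    refine integral_mono_ae (s.integrable_occTotal π n) (integrable_const _) ?_
    filter_upwards [s.ae_seqLaw] with T hT
    exact occTotal_le π n hT
  simpa using h

theorem meanAgeTotal_sub_const (π : Policy s.B) (φ : ℕ → ℝ) (g : ℝ) (n : ℕ) :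
    s.meanAgeTotal π (fun k => φ k - g) n = s.meanAgeTotal π φ n - n * g := by
  have h : (n : ℝ) * g = ∫ _, (n : ℝ) * g ∂s.seqLaw := by simp
  rw [h, meanAgeTotal, meanAgeTotal, ← integral_sub (s.integrable_ageTotal π φ n)
    (integrable_const _)]
  refine integral_congr_ae ?_
  filter_upwards [s.ae_seqLaw] with T hT
  rw [← s.sum_age π hT, ← s.sum_age π hT, Finset.sum_sub_distrib]
  simp

end Source

/-! ### The optimality equation and the index function. -/

namespace Source

variable (s : Source)

/-- The total error cost of the ages below `a`. -/
noncomputable def errSum (a : ℕ) : ℝ := ∑ k ∈ Finset.range a, s.w * s.p k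

theorem sum_shift (δ m : ℕ) :
    ∑ k ∈ Finset.range m, s.w * s.p (δ + k) = s.errSum (δ + m) - s.errSum δ := by
  rw [errSum, errSum, Finset.sum_range_add]
  ring

section

variable {s} (hint : ∀ δ : ℕ,
  Integrable (fun T : ℕ => ∑ k ∈ Finset.range T, s.p (δ + k)) s.law.toMeasure)
include hint

theorem integrable_cost_sum (δ : ℕ) :
    Integrable (fun T : ℕ => ∑ k ∈ Finset.range T, s.w * s.p (δ + k)) s.law.toMeasure := by
  simpa only [Finset.mul_sum] using (hint δ).const_mul s.w

/-- The single term at age `δ + T` is a difference of two shifted sums: the sum from `δ + 1` minus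
the sum from `δ`, plus the term at `δ`. -/
theorem integrable_cost (δ : ℕ) :
    Integrable (fun T : ℕ => s.w * s.p (δ + T)) s.law.toMeasure := by
  have h := ((integrable_const (s.w * s.p δ)).sub (integrable_cost_sum hint δ)).add
    (integrable_cost_sum hint (δ + 1))
  refine h.congr (Eventually.of_forall fun T => ?_)
  simp only [Pi.add_apply, Pi.sub_apply, sum_shift]
  have h1 : s.errSum (δ + 1) = s.errSum δ + s.w * s.p δ := Finset.sum_range_succ _ _
  have h2 : s.errSum (δ + T + 1) = s.errSum (δ + T) + s.w * s.p (δ + T) :=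
    Finset.sum_range_succ _ _
  rw [show δ + 1 + T = δ + T + 1 by ring, h1, h2]
  ring

theorem integrable_errSum (b : ℕ) :
    Integrable (fun T : ℕ => s.errSum (T + b)) s.law.toMeasure := by
  refine ((integrable_cost_sum hint b).add (integrable_const (s.errSum b))).congr
    (Eventually.of_forall fun T => ?_)
  simp only [Pi.add_apply, sum_shift, add_comm b T]
  ring

/-- Splitting the `τ + T` slots after the first `T` puts the extra slots at the end of the cycle, at
ages `δ + T + k`. This is where the shift by `T` in `γ` comes from. -/
theorem cycleCost_eq (δ τ : ℕ) : s.cycleCost δ τ = s.cycleCost δ 0 +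
    ∑ k ∈ Finset.range τ, ∫ T : ℕ, s.w * s.p (δ + k + T) ∂s.law.toMeasure := by
  have h (k : ℕ) := integrable_cost hint (δ + k)
  rw [cycleCost, cycleCost, ← integral_finsetSum _ fun k _ => h k,
    ← integral_add (by simpa using integrable_cost_sum hint δ) (integrable_finsetSum _ fun k _ => h k)]
  congr 1
  funext T
  rw [add_comm τ T, Finset.sum_range_add, zero_add]
  congr 1
  refine Finset.sum_congr rfl fun k _ => ?_
  congr 2
  ring

theorem transmitOptimal_iff (lam : ℝ) (δ : ℕ) :
    s.TransmitOptimal lam δ ↔ s.optVal lam ≤ s.gam δ := by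
  unfold TransmitOptimal gam
  rw [le_iInf_iff]
  have key : ∀ τ : ℕ, 0 < τ → (((s.cycleCost δ 0 : EReal) + (τ : EReal) * s.optVal lam ≤
      (s.cycleCost δ τ : EReal)) ↔ s.optVal lam ≤ (((1 / (τ : ℝ)) * ∑ k ∈ Finset.range τ,
        ∫ T : ℕ, s.w * s.p (δ + k + T) ∂s.law.toMeasure : ℝ) : EReal)) := by
    intro τ hτ
    have hτ' : (0 : ℝ) < τ := by exact_mod_cast hτ
    have hcast : ((τ : ℕ) : EReal) = ((τ : ℝ) : EReal) := rfl
    rw [cycleCost_eq hint δ τ, hcast]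
    -- At the value `⊥` both sides hold and at `⊤` both fail. This needs `τ > 0`, since `0 * ⊤ = 0`
    -- in `EReal`; the case `τ = 0` is trivial and treated apart.
    induction s.optVal lam with
    | bot =>
      rw [EReal.coe_mul_bot_of_pos hτ', EReal.add_bot]
      simp only [bot_le]
    | top =>
      rw [EReal.coe_mul_top_of_pos hτ', EReal.coe_add_top]
      simp only [top_le_iff, EReal.coe_ne_top]
    | coe g =>
      rw [← EReal.coe_mul, ← EReal.coe_add, EReal.coe_le_coe_iff, EReal.coe_le_coe_iff,
        add_le_add_iff_left, one_div, inv_mul_eq_div, le_div_iff₀' hτ']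
  constructor
  · intro h τ
    exact (key τ τ.pos).1 (h τ)
  · intro h τ
    rcases Nat.eq_zero_or_pos τ with rfl | hτ
    · simp
    · exact (key τ hτ).2 (h ⟨τ, hτ⟩)

end

/-! ### Lower bounds from the silent level, and monotonicity of the optimal value. -/

theorem exists_errSum_ge {L : ℝ} (hL : (L : EReal) < s.silentLevel) :
    ∃ C : ℝ, 0 ≤ C ∧ ∀ n : ℕ, L * n - C ≤ s.errSum n := by
  obtain ⟨N, hN⟩ := eventually_atTop.1 (eventually_lt_of_lt_liminf hL)
  refine ⟨∑ j ∈ Finset.range (N + 1), |L * j - s.errSum j|,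
    Finset.sum_nonneg fun _ _ => abs_nonneg _, fun n => ?_⟩
  rcases lt_or_ge n (N + 1) with h | h
  · have := Finset.single_le_sum (f := fun j : ℕ => |L * j - s.errSum j|)
      (fun _ _ => abs_nonneg _) (Finset.mem_range.2 h)
    have := le_abs_self (L * n - s.errSum n)
    linarith
  · have h1 := hN n (by omega)
    have hn : (0 : ℝ) < n := by exact_mod_cast (show 0 < n by omega)
    rw [EReal.coe_lt_coe_iff, one_div, inv_mul_eq_div, lt_div_iff₀ hn] at h1
    have : 0 ≤ ∑ j ∈ Finset.range (N + 1), |L * j - s.errSum j| :=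
      Finset.sum_nonneg fun _ _ => abs_nonneg _
    unfold errSum at *
    linarith

theorem sum_range_blocks_card {e : ℕ → ℕ} (he : Monotone e) {n : ℕ} (hn : n ≤ e n) :
    (n : ℝ) = (min n (e 0) : ℕ) +
      ∑ i ∈ Finset.range n, ((min n (e (i + 1)) - min n (e i) : ℕ) : ℝ) := by
  simpa using sum_range_blocks (fun _ => 1) he hn

/-- If every age sum is at least `L` per slot up to a constant, then the error cost per slot is at
least `L`, up to a constant for each transmission. -/
theorem exists_meanAgeTotal_ge
    (hint : ∀ δ : ℕ, Integrable (fun T : ℕ => ∑ k ∈ Finset.range T, s.p (δ + k)) s.law.toMeasure)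
    {L : ℝ} (hL : (L : EReal) < s.silentLevel) :
    ∃ C : ℝ, 0 ≤ C ∧ ∀ (π : Policy s.B) (n : ℕ),
      L * n - C * (s.meanCount π n + 1) ≤ s.meanAgeTotal π (fun k => s.w * s.p k) n := by
  obtain ⟨C, hC, hW⟩ := s.exists_errSum_ge hL
  -- The ages from `x` to `x + m` cost at least `L m` minus the defect `C - L x + errSum x`. At a
  -- delivery `x = t + b` with `b < B`; summing over all `b` bounds the defect by an integrable
  -- function of `t` alone.
  set F : ℕ → ℝ := fun t => C + ∑ b ∈ Finset.range s.B, (|L| * (t + b) + |s.errSum (t + b)|)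
    with hFdef
  have hF : Integrable F s.law.toMeasure := by
    refine (integrable_const C).add (integrable_finsetSum _ fun b _ => ?_)
    exact ((s.law_mean.add (integrable_const (b : ℝ))).const_mul |L|).add
      (integrable_errSum hint b).abs
  have hF0 : ∀ t, 0 ≤ F t := fun t => by positivity
  have hFb : ∀ t b, b < s.B → C - L * (t + b : ℕ) + s.errSum (t + b) ≤ F t := by
    intro t b hb
    have h1 := Finset.single_le_sum
      (f := fun b : ℕ => |L| * ((t : ℝ) + b) + |s.errSum (t + b)|)
      (fun _ _ => by positivity) (Finset.mem_range.2 hb)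
    have h2 := le_abs_self (s.errSum (t + b))
    have h3 : -(L * (t + b : ℕ)) ≤ |L| * ((t : ℝ) + b) := by
      push_cast
      nlinarith [neg_abs_le L, (by positivity : (0 : ℝ) ≤ (t : ℝ) + b)]
    simp only [hFdef]
    linarith
  set C₀ : ℝ := |C - L * s.age₀ + s.errSum s.age₀|
  refine ⟨max (∫ t, F t ∂s.law.toMeasure) C₀, le_max_of_le_right (abs_nonneg _),
    fun π n => ?_⟩
  have hle := le_integral_sum_started π n (fun _ t => - F t) hF
    (fun b _ t => by rw [abs_neg, abs_of_nonneg (hF0 t)]) (c := - ∫ t, F t ∂s.law.toMeasure)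
    (fun b _ => by rw [integral_neg])
  have hmono : ∫ T, (L * n - C₀ +
      ∑ i ∈ Finset.range n, π.started n T i * (- F (T i))) ∂s.seqLaw ≤
      s.meanAgeTotal π (fun k => s.w * s.p k) n := by
    refine integral_mono_ae ((integrable_const _).add hle.1) (s.integrable_ageTotal π _ n) ?_
    filter_upwards [s.ae_seqLaw] with T hT
    rw [ageTotal, s.sum_shift]
    have e := sum_range_blocks_card (π.deliver_strictMono hT).monotone (π.le_deliver hT n)
    rw [show L * (n : ℝ) = L * (min n (π.deliver T 0) : ℕ) + ∑ i ∈ Finset.range n,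
      L * ((min n (π.deliver T (i + 1)) - min n (π.deliver T i) : ℕ) : ℝ) by
        rw [← Finset.mul_sum, ← mul_add, ← e]]
    have h0 := hW (s.age₀ + min n (π.deliver T 0))
    have h0' := le_abs_self (C - L * s.age₀ + s.errSum s.age₀)
    rw [Nat.cast_add] at h0
    have hsum : ∑ i ∈ Finset.range n,
        (L * ((min n (π.deliver T (i + 1)) - min n (π.deliver T i) : ℕ) : ℝ) +
          π.started n T i * (- F (T i))) ≤ ∑ i ∈ Finset.range n,
        ∑ k ∈ Finset.range (min n (π.deliver T (i + 1)) - min n (π.deliver T i)),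
          s.w * s.p (s.delAge π T i + k) := by
      refine Finset.sum_le_sum fun i _ => ?_
      have hd := π.submit_lt_deliver hT i
      have hd' := π.deliver_strictMono hT (Nat.lt_add_one i)
      unfold Policy.started
      split_ifs with h
      · rw [s.sum_shift]
        have h1 := hW (s.delAge π T i + (min n (π.deliver T (i + 1)) - min n (π.deliver T i)))
        have h2 := hFb (T i) _ (s.effPos_lt π T i)
        rw [Nat.cast_add] at h1
        simp only [delAge] at *
        linarith
      · rw [show min n (π.deliver T (i + 1)) - min n (π.deliver T i) = 0 by omega]
        simp
    rw [Finset.sum_add_distrib] at hsum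
    linarith
  rw [integral_add (integrable_const _) hle.1, integral_const] at hmono
  simp only [probReal_univ, one_smul] at hmono
  have hc := s.meanCount_nonneg π n
  have h1 := mul_le_mul_of_nonneg_right (le_max_left (∫ t, F t ∂s.law.toMeasure) C₀) hc
  have h2 := le_max_right (∫ t, F t ∂s.law.toMeasure) C₀
  have h3 := hle.2
  unfold meanCount at *
  linarith

theorem meanCost_mono (π : Policy s.B) (n : ℕ) : Monotone fun lam => s.meanCost lam π n := by
  intro lam₁ lam₂ h
  exact mul_le_mul_of_nonneg_left
    (add_le_add_right (mul_le_mul_of_nonneg_right h (s.meanOcc_nonneg π n)) _) (by positivity)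

theorem optVal_mono : Monotone s.optVal := by
  intro lam₁ lam₂ h
  refine iInf_mono fun π => ?_
  rw [avgCost_eq, avgCost_eq]
  exact limsup_le_limsup (Eventually.of_forall fun n =>
    EReal.coe_le_coe_iff.2 (s.meanCost_mono π n h))

/-- A bound that is valid at all large times bounds the average cost from below. -/
theorem le_avgCost {lam : ℝ} {π : Policy s.B} {c : ℝ}
    (h : ∀ᶠ n in atTop, c ≤ s.meanCost lam π n) : (c : EReal) ≤ s.avgCost lam π := by
  rw [avgCost_eq]
  refine le_limsup_of_frequently_le ?_ (by isBoundedDefault)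
  exact (h.mono fun n hn => EReal.coe_le_coe_iff.2 hn).frequently

/-- At most one feature is submitted per slot, so the constant lost per transmission in
`exists_meanAgeTotal_ge` is a bounded loss per slot. -/
theorem optVal_ne_bot
    (hint : ∀ δ : ℕ, Integrable (fun T : ℕ => ∑ k ∈ Finset.range T, s.p (δ + k)) s.law.toMeasure)
    (hs : s.silentLevel ≠ ⊥) (lam : ℝ) : s.optVal lam ≠ ⊥ := by
  obtain ⟨L, -, hL⟩ := EReal.lt_iff_exists_real_btwn.1 (bot_lt_iff_ne_bot.2 hs)
  obtain ⟨C, hC, h⟩ := s.exists_meanAgeTotal_ge hint hL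
  have hle : ((L - 2 * C - |lam| : ℝ) : EReal) ≤ s.optVal lam := by
    refine le_iInf fun π => s.le_avgCost ?_
    filter_upwards [eventually_ge_atTop 1] with n hn
    have hn' : (1 : ℝ) ≤ n := by exact_mod_cast hn
    rw [meanCost, one_div, inv_mul_eq_div, le_div_iff₀ (by linarith)]
    have h1 := s.meanCount_le_meanOcc π n
    have h2 := s.meanOcc_le π n
    have h3 := s.meanOcc_nonneg π n
    have h4 := h π n
    have h5 : -(|lam| * n) ≤ lam * s.meanOcc π n := by
      nlinarith [neg_abs_le lam, abs_nonneg lam]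
    nlinarith [mul_le_mul_of_nonneg_left (h1.trans h2) hC]
  exact ne_bot_of_le_ne_bot (EReal.coe_ne_bot _) hle

/-- If the values agreed, a policy within `ε` of the optimum at `lam₂` would, at infinitely many
horizons, save at most `2 ε` per slot by switching to `lam₁`. Its channel use is then at most `2 ε /
(lam₂ - lam₁)` per slot, so it is almost silent and pays nearly `L > g`. -/
theorem optVal_strict
    (hint : ∀ δ : ℕ, Integrable (fun T : ℕ => ∑ k ∈ Finset.range T, s.p (δ + k)) s.law.toMeasure)
    {lam₁ lam₂ : ℝ} (hlam : lam₁ < lam₂) (hs : s.optVal lam₁ < s.silentLevel) :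
    s.optVal lam₁ < s.optVal lam₂ := by
  obtain ⟨g, hg⟩ : ∃ g : ℝ, s.optVal lam₁ = g := by
    refine ⟨(s.optVal lam₁).toReal, (EReal.coe_toReal hs.ne_top ?_).symm⟩
    exact s.optVal_ne_bot hint (bot_le.trans_lt hs).ne' lam₁
  rw [hg] at hs ⊢
  obtain ⟨L, hgL, hL⟩ := EReal.lt_iff_exists_real_btwn.1 hs
  rw [EReal.coe_lt_coe_iff] at hgL
  obtain ⟨C, hC, h⟩ := s.exists_meanAgeTotal_ge hint hL
  by_contra! hcon
  set c := lam₂ - lam₁ with hc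
  have hc0 : 0 < c := sub_pos.2 hlam
  -- The gap `L - g` has to absorb `ε` itself and the price `C + |lam₁|` for each occupied slot.
  -- Half of the gap is kept for the additive constant `C`, which the choice of `N` controls.
  obtain ⟨ε, hε, hε'⟩ : ∃ ε : ℝ, 0 < ε ∧ ε * (1 + (C + |lam₁|) * (2 / c)) < (L - g) / 2 := by
    have hpos : 0 < 1 + (C + |lam₁|) * (2 / c) := by positivity
    refine ⟨(L - g) / 4 / (1 + (C + |lam₁|) * (2 / c)), div_pos (by linarith) hpos, ?_⟩
    rw [div_mul_cancel₀ _ hpos.ne']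
    linarith
  obtain ⟨π, hπ⟩ : ∃ π : Policy s.B, s.avgCost lam₂ π < ((g + ε : ℝ) : EReal) := by
    rw [← iInf_lt_iff]
    exact hcon.trans_lt (EReal.coe_lt_coe_iff.2 (by linarith))
  rw [avgCost_eq] at hπ
  have hev := eventually_lt_of_limsup_lt hπ
  -- A limsup gives a lower bound only frequently but an upper bound eventually, so there is a large
  -- horizon at which both hold.
  have hfr : ∃ᶠ n in atTop, ((g - ε : ℝ) : EReal) < ((s.meanCost lam₁ π n : ℝ) : EReal) := by
    refine frequently_lt_of_lt_limsup (by isBoundedDefault) ?_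
    rw [← avgCost_eq]
    refine lt_of_lt_of_le (EReal.coe_lt_coe_iff.2 (by linarith : g - ε < g)) ?_
    rw [← hg]
    exact iInf_le _ π
  obtain ⟨N, hN⟩ := exists_nat_gt (C / ((L - g) / 2))
  obtain ⟨n, hn₁, hn₂, hn⟩ := (hfr.and_eventually (hev.and (eventually_ge_atTop (N + 1)))).exists
  rw [EReal.coe_lt_coe_iff] at hn₁ hn₂
  have hn' : (N : ℝ) + 1 ≤ n := by exact_mod_cast hn
  have hN0 : (0 : ℝ) ≤ N := Nat.cast_nonneg _
  have hn0 : (0 : ℝ) < n := by linarith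
  rw [meanCost, one_div, inv_mul_eq_div, lt_div_iff₀ hn0] at hn₁
  rw [meanCost, one_div, inv_mul_eq_div, div_lt_iff₀ hn0] at hn₂
  have hoccnn := s.meanOcc_nonneg π n
  have hocc : s.meanOcc π n ≤ 2 / c * (ε * n) := by
    rw [div_mul_eq_mul_div, le_div_iff₀ hc0]
    nlinarith
  have h1 := mul_le_mul_of_nonneg_left ((s.meanCount_le_meanOcc π n).trans hocc) hC
  have h2 : -(|lam₁| * (2 / c * (ε * n))) ≤ lam₁ * s.meanOcc π n := by
    nlinarith [neg_abs_le lam₁, mul_le_mul_of_nonneg_left hocc (abs_nonneg lam₁)]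
  have h3 := h π n
  have h4 : lam₁ * s.meanOcc π n ≤ lam₂ * s.meanOcc π n :=
    mul_le_mul_of_nonneg_right hlam.le hoccnn
  rw [div_lt_iff₀ (by linarith)] at hN
  have h5 := mul_lt_mul_of_pos_right hε' hn0
  have h6 : C < (L - g) / 2 * n := by nlinarith
  nlinarith

end Source

/-! ### Decomposition of the total cost into cycles. -/

/-- The total of `φ` over the ages `x, …, x + m - 1`. -/
def ageSum (φ : ℕ → ℝ) (x m : ℕ) : ℝ := ∑ k ∈ Finset.range m, φ (x + k)

theorem ageSum_add (φ : ℕ → ℝ) (x m j : ℕ) :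
    ageSum φ x (m + j) = ageSum φ x m + ageSum φ (x + m) j := by
  simp only [ageSum, Finset.sum_range_add, add_assoc]

theorem abs_ageSum_le {φ : ℕ → ℝ} {C : ℝ} (hφ : ∀ k, |φ k| ≤ C) (x m : ℕ) :
    |ageSum φ x m| ≤ C * m := by
  refine (Finset.abs_sum_le_sum_abs _ _).trans
    ((Finset.sum_le_sum fun k _ => hφ (x + k)).trans ?_)
  simp [mul_comm]

namespace Source

variable (s : Source)

/-- The mean transmission time. -/
noncomputable def meanTime : ℝ := ∫ t : ℕ, (t : ℝ) ∂s.law.toMeasure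

theorem meanTime_nonneg : 0 ≤ s.meanTime := integral_nonneg fun _ => Nat.cast_nonneg _

theorem integrable_one_add : Integrable (fun t : ℕ => 1 + (t : ℝ)) s.law.toMeasure :=
  (integrable_const (1 : ℝ)).add s.law_mean

theorem integrable_ageSum {φ : ℕ → ℝ} {C : ℝ} (hφ : ∀ k, |φ k| ≤ C) (x : ℕ) :
    Integrable (fun t => ageSum φ x t) s.law.toMeasure :=
  (s.law_mean.const_mul C).mono' (measurable_of_countable _).aestronglyMeasurable
    (Eventually.of_forall fun t => abs_ageSum_le hφ x t)

/-- The expected total of `φ` over the ages during a transmission that starts at age `x`. -/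
noncomputable def serviceMean (φ : ℕ → ℝ) (x : ℕ) : ℝ := ∫ t, ageSum φ x t ∂s.law.toMeasure

theorem abs_serviceMean_le {φ : ℕ → ℝ} {C : ℝ} (hφ : ∀ k, |φ k| ≤ C) (x : ℕ) :
    |s.serviceMean φ x| ≤ C * s.meanTime := by
  rw [serviceMean, meanTime, ← integral_const_mul]
  refine (abs_integral_le_integral_abs).trans ?_
  exact integral_mono (s.integrable_ageSum hφ x).abs (s.law_mean.const_mul C)
    fun t => abs_ageSum_le hφ x t

/-- The part of `1 + t` that exceeds the level `R`. -/
noncomputable def tail (R : ℝ) (t : ℕ) : ℝ := if R < 1 + (t : ℝ) then 1 + (t : ℝ) else 0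

theorem tail_nonneg (R : ℝ) (t : ℕ) : 0 ≤ tail R t := by
  unfold tail; split_ifs <;> positivity

theorem tail_le (R : ℝ) (t : ℕ) : tail R t ≤ 1 + t := by
  unfold tail
  split_ifs
  · rfl
  · positivity

theorem integrable_tail (R : ℝ) : Integrable (tail R) s.law.toMeasure :=
  s.integrable_one_add.mono' (measurable_of_countable _).aestronglyMeasurable
    (Eventually.of_forall fun t => by
      rw [Real.norm_eq_abs, abs_of_nonneg (tail_nonneg R t)]; exact tail_le R t)

/-- The feature in progress at slot `n` has a size-biased transmission time, whose mean may be
infinite. Truncation at `R` bounds it by `R` plus a small amount per started feature, which suffices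
for averages over time. -/
theorem exists_integral_tail_le {η : ℝ} (hη : 0 < η) :
    ∃ R : ℝ, 0 ≤ R ∧ ∫ t, tail R t ∂s.law.toMeasure ≤ η := by
  have h : Tendsto (fun n : ℕ => ∫ t, tail n t ∂s.law.toMeasure) atTop
      (nhds (∫ _, 0 ∂s.law.toMeasure)) := by
    refine tendsto_integral_of_dominated_convergence (fun t => 1 + (t : ℝ))
      (fun n => (measurable_of_countable _).aestronglyMeasurable) s.integrable_one_add
      (fun n => Eventually.of_forall fun t => ?_) (Eventually.of_forall fun t => ?_)
    · rw [Real.norm_eq_abs, abs_of_nonneg (tail_nonneg _ t)]; exact tail_le _ t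
    · refine tendsto_const_nhds.congr' ?_
      filter_upwards [eventually_ge_atTop (t + 1)] with n hn
      have : (t : ℝ) + 1 ≤ n := by exact_mod_cast hn
      rw [tail, if_neg (by linarith)]
  rw [integral_zero] at h
  obtain ⟨n, hn⟩ := (h.eventually_le_const hη).exists
  exact ⟨n, Nat.cast_nonneg _, hn⟩

theorem meanOcc_le_mul_meanCount (π : Policy s.B) (n : ℕ) :
    s.meanOcc π n ≤ s.meanTime * s.meanCount π n := by
  have h := le_integral_sum_started π n (fun _ t => - (t : ℝ)) s.law_mean
    (fun b _ t => by rw [abs_neg, Nat.abs_cast]) (c := - s.meanTime)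
    (fun b _ => by rw [integral_neg, meanTime])
  have h' : ∫ T, ∑ i ∈ Finset.range n, π.started n T i * (-(T i : ℝ)) ∂s.seqLaw ≤
      ∫ T, - π.occTotal n T ∂s.seqLaw := by
    refine integral_mono_ae h.1 (s.integrable_occTotal π n).neg ?_
    filter_upwards [s.ae_seqLaw] with T hT
    simp only [Policy.occTotal, ← Finset.sum_neg_distrib]
    refine Finset.sum_le_sum fun i _ => ?_
    rw [mul_neg, neg_le_neg_iff]
    have h3 : π.deliver T i = π.submit T i + T i := rfl
    unfold Policy.started
    split_ifs with hlt
    · rw [one_mul]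
      exact_mod_cast (by omega : min n (π.deliver T i) - min n (π.submit T i) ≤ T i)
    · rw [show min n (π.deliver T i) - min n (π.submit T i) = 0 by omega]
      simp
  rw [integral_neg] at h'
  have h2 := h.2
  unfold meanOcc meanCount at *
  linarith

section PathBounds

variable {s} {π : Policy s.B} {T : ℕ → ℕ} {φ u : ℕ → ℝ} {C : ℝ}

/-- The cost between two deliveries, stopped at slot `n`, is at least the value `v` of the age at
the first of them, plus a term of mean zero for the transmission, up to an error if `n` falls into
this interval. -/
theorem block_ge (hT : ∀ i, 1 ≤ T i) (hφ : ∀ k, |φ k| ≤ C) (n i : ℕ) {v : ℝ}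
    (h₁ : v ≤ ageSum φ (s.delAge π T i) (π.wait i T) + u (s.subAge π T (i + 1)))
    (h₂ : ∀ m ≤ π.wait i T, v - C * (1 + (T i : ℝ)) ≤ ageSum φ (s.delAge π T i) m) :
    π.started n T i * v +
        π.started n T (i + 1) *
          (ageSum φ (s.subAge π T (i + 1)) (T (i + 1)) - u (s.subAge π T (i + 1))) -
        C * ((π.started n T i - π.started n T (i + 1)) * (1 + (T i : ℝ))) -
        C * ((π.started n T (i + 1) - π.started n T (i + 2)) * (1 + (T (i + 1) : ℝ))) ≤
      ageSum φ (s.delAge π T i) (min n (π.deliver T (i + 1)) - min n (π.deliver T i)) := by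
  have hC : 0 ≤ C := (abs_nonneg _).trans (hφ 0)
  have hd : π.submit T i < π.deliver T i := π.submit_lt_deliver hT i
  have hd' : π.deliver T i < π.deliver T (i + 1) := π.deliver_strictMono hT (Nat.lt_add_one i)
  have hs : π.submit T (i + 1) = π.deliver T i + π.wait i T := rfl
  have hs' : π.deliver T (i + 1) = π.submit T (i + 1) + T (i + 1) := rfl
  have hx : s.subAge π T (i + 1) = s.delAge π T i + π.wait i T := rfl
  have hs'' : π.deliver T (i + 1) ≤ π.submit T (i + 2) := π.deliver_le_submit T (i + 1)
  by_cases hi : π.submit T i < n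
  · have e0 : π.started n T i = 1 := if_pos hi
    by_cases hi1 : π.submit T (i + 1) < n
    · have e1 : π.started n T (i + 1) = 1 := if_pos hi1
      rw [e0, e1, show min n (π.deliver T (i + 1)) - min n (π.deliver T i) =
        π.wait i T + min (n - π.submit T (i + 1)) (T (i + 1)) by omega, ageSum_add, ← hx]
      by_cases hi2 : π.submit T (i + 2) < n
      · have e2 : π.started n T (i + 2) = 1 := if_pos hi2
        rw [e2, min_eq_right (by omega)]
        linarith
      · have e2 : π.started n T (i + 2) = 0 := if_neg hi2
        have hsplit := ageSum_add φ (s.subAge π T (i + 1))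
          (min (n - π.submit T (i + 1)) (T (i + 1)))
          (T (i + 1) - min (n - π.submit T (i + 1)) (T (i + 1)))
        rw [show min (n - π.submit T (i + 1)) (T (i + 1)) +
          (T (i + 1) - min (n - π.submit T (i + 1)) (T (i + 1))) = T (i + 1) by omega] at hsplit
        have hb := (abs_le.1 (abs_ageSum_le hφ
          (s.subAge π T (i + 1) + min (n - π.submit T (i + 1)) (T (i + 1)))
          (T (i + 1) - min (n - π.submit T (i + 1)) (T (i + 1))))).2
        have hb' : C * ((T (i + 1) - min (n - π.submit T (i + 1)) (T (i + 1)) : ℕ) : ℝ) ≤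
            C * T (i + 1) :=
          mul_le_mul_of_nonneg_left (by exact_mod_cast Nat.sub_le _ _) hC
        rw [e2]
        linarith
    · have e1 : π.started n T (i + 1) = 0 := if_neg hi1
      have hlt : π.submit T (i + 1) < π.submit T (i + 2) :=
        π.submit_strictMono hT (Nat.lt_add_one _)
      have e2 : π.started n T (i + 2) = 0 := if_neg (by omega)
      rw [e0, e1, e2]
      have := h₂ (min n (π.deliver T (i + 1)) - min n (π.deliver T i)) (by omega)
      linarith
  · have hlt : π.submit T (i + 1) < π.submit T (i + 2) :=
      π.submit_strictMono hT (Nat.lt_add_one _)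
    have e0 : π.started n T i = 0 := if_neg hi
    have e1 : π.started n T (i + 1) = 0 := if_neg (by omega)
    have e2 : π.started n T (i + 2) = 0 := if_neg (by omega)
    rw [e0, e1, e2, show min n (π.deliver T (i + 1)) - min n (π.deliver T i) = 0 by omega]
    simp [ageSum]

theorem ageTotal_ge (hT : ∀ i, 1 ≤ T i) (hφ : ∀ k, |φ k| ≤ C) (n : ℕ) {V : ℕ → ℝ}
    (h₁ : ∀ i, V i ≤ ageSum φ (s.delAge π T i) (π.wait i T) + u (s.subAge π T (i + 1)))
    (h₂ : ∀ i, ∀ m ≤ π.wait i T, V i - C * (1 + (T i : ℝ)) ≤ ageSum φ (s.delAge π T i) m) :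
    ∑ i ∈ Finset.range n, π.started n T i * V i +
        ∑ i ∈ Finset.range n, π.started n T (i + 1) *
          (ageSum φ (s.subAge π T (i + 1)) (T (i + 1)) - u (s.subAge π T (i + 1))) -
        2 * C * ∑ i ∈ Finset.range n,
          (π.started n T i - π.started n T (i + 1)) * (1 + (T i : ℝ)) - C * T 0 ≤
      s.ageTotal π φ n T := by
  have hC : 0 ≤ C := (abs_nonneg _).trans (hφ 0)
  have hsum := Finset.sum_le_sum fun i (_ : i ∈ Finset.range n) =>
    block_ge hT hφ n i (h₁ i) (h₂ i)
  simp only [Finset.sum_sub_distrib, Finset.sum_add_distrib, ← Finset.mul_sum] at hsum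
  have hinit := (abs_le.1 (abs_ageSum_le hφ s.age₀ (min n (π.deliver T 0)))).1
  have hinit' : C * ((min n (π.deliver T 0) : ℕ) : ℝ) ≤ C * T 0 := by
    refine mul_le_mul_of_nonneg_left ?_ hC
    rw [π.deliver_zero]
    exact_mod_cast min_le_right _ _
  -- Each block has a boundary error for feature `i` and one for feature `i + 1`. After reindexing,
  -- the second sum is at most the first: the term at index `n` vanishes because no feature `i ≥ n`
  -- starts before slot `n`.
  have hshift := Finset.sum_range_succ'
    (fun i => (π.started n T i - π.started n T (i + 1)) * (1 + (T i : ℝ))) n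
  rw [Finset.sum_range_succ, π.started_eq_zero hT le_rfl,
    π.started_eq_zero hT (Nat.le_succ n)] at hshift
  have hnn : 0 ≤ (π.started n T 0 - π.started n T (0 + 1)) * (1 + (T 0 : ℝ)) :=
    mul_nonneg (sub_nonneg.2 (π.started_anti hT n 0)) (by positivity)
  have hle : ∑ i ∈ Finset.range n,
      (π.started n T (i + 1) - π.started n T (i + 2)) * (1 + (T (i + 1) : ℝ)) ≤
      ∑ i ∈ Finset.range n, (π.started n T i - π.started n T (i + 1)) * (1 + (T i : ℝ)) := by
    simp only [add_assoc, Nat.reduceAdd] at hshift hnn ⊢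
    linarith
  have hle' := mul_le_mul_of_nonneg_left hle hC
  unfold ageTotal
  unfold ageSum at *
  linarith

end PathBounds

variable {s} in
/-- The transmissions contribute terms of mean zero. -/
theorem integral_sum_service (π : Policy s.B) (n : ℕ) {φ : ℕ → ℝ} {C : ℝ}
    (hφ : ∀ k, |φ k| ≤ C) :
    Integrable (fun T => ∑ i ∈ Finset.range n, π.started n T (i + 1) *
      (ageSum φ (s.subAge π T (i + 1)) (T (i + 1)) - s.serviceMean φ (s.subAge π T (i + 1))))
      s.seqLaw ∧
    ∫ T, ∑ i ∈ Finset.range n, π.started n T (i + 1) *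
      (ageSum φ (s.subAge π T (i + 1)) (T (i + 1)) - s.serviceMean φ (s.subAge π T (i + 1)))
      ∂s.seqLaw = 0 := by
  have hH : ∀ i, ∀ T T' t, (∀ j < i, T j = T' j) →
      π.started n T i * (ageSum φ (s.subAge π T i) t - s.serviceMean φ (s.subAge π T i)) =
      π.started n T' i * (ageSum φ (s.subAge π T' i) t - s.serviceMean φ (s.subAge π T' i)) := by
    intro i T T' t h
    rw [π.started_congr n h, s.subAge_congr π h]
  have hb : ∀ i T t, |π.started n T i *
      (ageSum φ (s.subAge π T i) t - s.serviceMean φ (s.subAge π T i))| ≤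
        C * t + C * s.meanTime := by
    intro i T t
    rw [abs_mul, abs_of_nonneg (π.started_nonneg n T i)]
    refine (mul_le_of_le_one_left (abs_nonneg _) (π.started_le_one n T i)).trans ?_
    exact (abs_sub _ _).trans (add_le_add (abs_ageSum_le hφ _ _) (s.abs_serviceMean_le hφ _))
  have hF : Integrable (fun t : ℕ => C * (t : ℝ) + C * s.meanTime) s.law.toMeasure :=
    (s.law_mean.const_mul C).add (integrable_const _)
  have hI := fun i => (integrable_eval_of_causal (hH i) hF (hb i)).2
  refine ⟨integrable_finsetSum _ fun i _ => hI (i + 1), ?_⟩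
  rw [integral_finsetSum _ fun i _ => hI (i + 1)]
  refine Finset.sum_eq_zero fun i _ => ?_
  rw [integral_eval_of_causal (hH (i + 1)) hF (hb (i + 1))]
  have : ∀ x, ∫ t, (ageSum φ x t - s.serviceMean φ x) ∂s.law.toMeasure = 0 := by
    intro x
    rw [integral_sub (s.integrable_ageSum hφ x) (integrable_const _), serviceMean, integral_const]
    simp
  simp only [integral_const_mul, this, mul_zero, integral_zero]

variable {s} in
/-- The main estimate of the total cost before slot `n`. Here `V T i` is the value of the age at the
delivery of feature `i`, and `G b t` bounds it in terms of the buffer position `b` and the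
transmission time `t`, except for finitely many features. -/
theorem meanAgeTotal_add_ge (π : Policy s.B) (n : ℕ) {φ : ℕ → ℝ} {C : ℝ}
    (hφ : ∀ k, |φ k| ≤ C) {V : (ℕ → ℕ) → ℕ → ℝ}
    (h₁ : ∀ T, (∀ i, 1 ≤ T i) → ∀ i, V T i ≤
      ageSum φ (s.delAge π T i) (π.wait i T) + s.serviceMean φ (s.subAge π T (i + 1)))
    (h₂ : ∀ T, (∀ i, 1 ≤ T i) → ∀ i, ∀ m ≤ π.wait i T,
      V T i - C * (1 + (T i : ℝ)) ≤ ageSum φ (s.delAge π T i) m)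
    {G : ℕ → ℕ → ℝ} {D : ℝ} (hD : 0 ≤ D) (hG : ∀ b < s.B, ∀ t, |G b t| ≤ D * (1 + (t : ℝ)))
    {k : ℕ} (hVG : ∀ T, (∀ i, 1 ≤ T i) → ∀ i,
      G (s.effPos π T i) (T i) - (if i < k then D * (1 + (T i : ℝ)) else 0) ≤ V T i)
    {c lam : ℝ} (hc : ∀ b < s.B, c ≤ ∫ t, G b t ∂s.law.toMeasure + lam * s.meanTime)
    {R : ℝ} (hR : 0 ≤ R) :
    (c - (2 * C + |lam|) * ∫ t, tail R t ∂s.law.toMeasure) * s.meanCount π n -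
        ((2 * C + |lam|) * R + C * s.meanTime + k * (D * (1 + s.meanTime))) ≤
      s.meanAgeTotal π φ n + lam * s.meanOcc π n := by
  have hC : 0 ≤ C := (abs_nonneg _).trans (hφ 0)
  -- The factor `2 * C` pays for the cycles cut at `n`, and `|lam|` for the occupation time cut
  -- there.
  set A := 2 * C + |lam| with hA
  have hA0 : 0 ≤ A := by positivity
  have hGint : ∀ b < s.B, Integrable (G b) s.law.toMeasure := fun b hb =>
    (s.integrable_one_add.const_mul D).mono' (measurable_of_countable _).aestronglyMeasurable
      (Eventually.of_forall fun t => hG b hb t)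
  have hle := le_integral_sum_started π n (fun b t => G b t + lam * t - A * tail R t)
    (F := fun t => (D + |lam| + A) * (1 + (t : ℝ))) (s.integrable_one_add.const_mul _)
    (fun b hb t => by
      have a1 := hG b hb t
      have a2 : |lam * (t : ℝ)| ≤ |lam| * (1 + (t : ℝ)) := by
        rw [abs_mul, Nat.abs_cast]
        exact mul_le_mul_of_nonneg_left (by linarith) (abs_nonneg _)
      have a3 : |A * tail R t| ≤ A * (1 + (t : ℝ)) := by
        rw [abs_mul, abs_of_nonneg hA0, abs_of_nonneg (tail_nonneg R t)]
        exact mul_le_mul_of_nonneg_left (tail_le R t) hA0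
      have a4 := abs_sub (G b t + lam * t) (A * tail R t)
      have a5 := abs_add_le (G b t) (lam * t)
      linarith)
    (c := c - A * ∫ t, tail R t ∂s.law.toMeasure)
    (fun b hb => by
      have e₁ := integral_sub' ((hGint b hb).add (s.law_mean.const_mul lam))
        ((s.integrable_tail R).const_mul A)
      simp only [Pi.sub_apply, Pi.add_apply] at e₁
      rw [e₁, integral_add (hGint b hb) (s.law_mean.const_mul lam),
        integral_const_mul, integral_const_mul]
      have := hc b hb
      unfold meanTime at this
      linarith)
  have hserv := integral_sum_service π n hφ
  have hT0 : Integrable (fun T : ℕ → ℕ => C * (T 0 : ℝ)) s.seqLaw :=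
    (integrable_eval s.law_mean 0).const_mul C
  have hTi : ∀ i, Integrable (fun T : ℕ → ℕ => D * (1 + (T i : ℝ))) s.seqLaw := fun i =>
    (integrable_eval s.integrable_one_add i).const_mul D
  have hTk : Integrable (fun T : ℕ → ℕ => ∑ i ∈ Finset.range k, D * (1 + (T i : ℝ))) s.seqLaw :=
    integrable_finsetSum _ fun i _ => hTi i
  have heval : ∀ i, ∫ T : ℕ → ℕ, (T i : ℝ) ∂s.seqLaw = s.meanTime := by
    intro i
    rw [integral_eval_of_causal (H := fun _ t => (t : ℝ)) (fun _ _ _ _ => rfl) s.law_mean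
      (fun _ t => (Nat.abs_cast t).le)]
    simp [meanTime]
  have hmono := integral_mono_ae
    ((((hle.1.add hserv.1).sub (integrable_const (A * R))).sub hT0).sub hTk)
    ((s.integrable_ageTotal π φ n).add ((s.integrable_occTotal π n).const_mul lam)) (by
      filter_upwards [s.ae_seqLaw] with T hT
      simp only [Pi.add_apply, Pi.sub_apply]
      have p1 := ageTotal_ge (u := s.serviceMean φ) hT hφ n (h₁ T hT) (h₂ T hT)
      have p2 := π.sum_last_le hT n n R hR
      have p3 := π.abs_occTotal_sub_le hT n
      have p4 : lam * π.occTotal n T ≥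
          lam * ∑ i ∈ Finset.range n, π.started n T i * (T i : ℝ) - |lam| *
            ∑ i ∈ Finset.range n,
              (π.started n T i - π.started n T (i + 1)) * (1 + (T i : ℝ)) := by
        have := mul_le_mul_of_nonneg_left p3 (abs_nonneg lam)
        rw [← abs_mul] at this
        have := (abs_le.1 this).1
        linarith
      have p5 : ∑ i ∈ Finset.range n,
          (if i < k then D * (1 + (T i : ℝ)) else 0) ≤
          ∑ i ∈ Finset.range k, D * (1 + (T i : ℝ)) := by
        rw [← Finset.sum_filter]
        refine Finset.sum_le_sum_of_subset_of_nonneg (fun i hi => ?_)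
          (fun i _ _ => by positivity)
        simpa using (Finset.mem_filter.1 hi).2
      have p6 : ∑ i ∈ Finset.range n, π.started n T i * G (s.effPos π T i) (T i) -
          ∑ i ∈ Finset.range n, (if i < k then D * (1 + (T i : ℝ)) else 0) ≤
          ∑ i ∈ Finset.range n, π.started n T i * V T i := by
        rw [← Finset.sum_sub_distrib]
        refine Finset.sum_le_sum fun i _ => ?_
        have q1 := mul_le_mul_of_nonneg_left (hVG T hT i) (π.started_nonneg n T i)
        have q2 : π.started n T i * (if i < k then D * (1 + (T i : ℝ)) else 0) ≤
            if i < k then D * (1 + (T i : ℝ)) else 0 :=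
          mul_le_of_le_one_left (by split_ifs <;> positivity) (π.started_le_one n T i)
        linarith
      have p7 : ∑ i ∈ Finset.range n, π.started n T i *
          (G (s.effPos π T i) (T i) + lam * (T i : ℝ) - A * tail R (T i)) =
          ∑ i ∈ Finset.range n, π.started n T i * G (s.effPos π T i) (T i) +
          lam * ∑ i ∈ Finset.range n, π.started n T i * (T i : ℝ) -
          A * ∑ i ∈ Finset.range n, π.started n T i * tail R (T i) := by
        rw [Finset.mul_sum, Finset.mul_sum, ← Finset.sum_add_distrib, ← Finset.sum_sub_distrib]
        exact Finset.sum_congr rfl fun i _ => by ring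
      have p8 := mul_le_mul_of_nonneg_left p2 hA0
      rw [p7]
      change A * _ ≤ A * (R + ∑ i ∈ Finset.range n, π.started n T i * tail R (T i)) at p8
      simp only [hA] at p8 ⊢
      linarith)
  rw [integral_sub' (((hle.1.add hserv.1).sub (integrable_const (A * R))).sub hT0) hTk,
    integral_sub' ((hle.1.add hserv.1).sub (integrable_const (A * R))) hT0,
    integral_sub' (hle.1.add hserv.1) (integrable_const (A * R)),
    integral_add' hle.1 hserv.1, hserv.2, integral_const_mul C, heval,
    integral_finsetSum _ (fun i _ => hTi i),
    integral_add' (s.integrable_ageTotal π φ n) ((s.integrable_occTotal π n).const_mul lam),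
    integral_const_mul lam] at hmono
  have hD1 : ∀ i, ∫ T : ℕ → ℕ, D * (1 + (T i : ℝ)) ∂s.seqLaw = D * (1 + s.meanTime) := by
    intro i
    rw [integral_const_mul, integral_add (integrable_const _) (integrable_eval s.law_mean i), heval]
    simp
  simp only [hD1, integral_const, probReal_univ, one_smul, Finset.sum_const, Finset.card_range,
    nsmul_eq_mul] at hmono
  have hle2 := hle.2
  unfold meanAgeTotal meanOcc
  unfold meanCount
  linarith

end Source

/-! ### The threshold policy. -/

namespace Source

variable (s : Source)

/-- The waiting time of an idle source of age `a` until transmitting at once becomes optimal. -/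
noncomputable def threshWait (lam : ℝ) (a : ℕ) : ℕ := sInf {m | s.TransmitOptimal lam (a + m)}

/-- The age at the delivery of feature `i` under the threshold policy. -/
noncomputable def threshAge (lam : ℝ) (b : Fin s.B) (T : ℕ → ℕ) : ℕ → ℕ
  | 0 => T 0 + s.pos₀
  | i + 1 => T (i + 1) + min (b : ℕ) (threshAge lam b T i + s.threshWait lam (threshAge lam b T i))

theorem threshAge_congr (lam : ℝ) (b : Fin s.B) {T T' : ℕ → ℕ} {i : ℕ}
    (h : ∀ j ≤ i, T j = T' j) : s.threshAge lam b T i = s.threshAge lam b T' i := by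
  induction i with
  | zero => simp only [threshAge, h 0 le_rfl]
  | succ i ih =>
    simp only [threshAge]
    rw [ih fun j hj => h j (by omega), h (i + 1) le_rfl]

/-- The policy that transmits from buffer position `b` as soon as transmitting is optimal. -/
noncomputable def threshPolicy (lam : ℝ) (b : Fin s.B) : Policy s.B where
  wait i T := s.threshWait lam (s.threshAge lam b T i)
  pos _ _ := b
  wait_causal _ _ _ h := by rw [s.threshAge_congr lam b h]
  pos_causal _ _ _ _ := rfl

theorem delAge_threshPolicy (lam : ℝ) (b : Fin s.B) (T : ℕ → ℕ) (i : ℕ) :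
    s.delAge (s.threshPolicy lam b) T i = s.threshAge lam b T i := by
  induction i with
  | zero => rfl
  | succ i ih =>
    change T (i + 1) + min (b : ℕ) (s.delAge (s.threshPolicy lam b) T i +
      s.threshWait lam (s.threshAge lam b T i)) = _
    rw [ih]
    rfl

theorem wait_threshPolicy (lam : ℝ) (b : Fin s.B) (T : ℕ → ℕ) (i : ℕ) :
    (s.threshPolicy lam b).wait i T =
      s.threshWait lam (s.delAge (s.threshPolicy lam b) T i) := by
  rw [delAge_threshPolicy]
  rfl

/-- An offset below `b` occurs only while an older feature is still fresher. Each transmission takes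
at least one slot, so the offset of feature `i` is at least `min b i`, and it has settled after `B`
features. -/
theorem effPos_threshPolicy (lam : ℝ) (b : Fin s.B) {T : ℕ → ℕ} (hT : ∀ i, 1 ≤ T i) {i : ℕ}
    (hi : s.B ≤ i) : s.effPos (s.threshPolicy lam b) T i = b := by
  have hle : ∀ i, s.effPos (s.threshPolicy lam b) T (i + 1) ≤ b := fun i => min_le_left _ _
  have h : ∀ i, min (b : ℕ) i ≤ s.effPos (s.threshPolicy lam b) T i := by
    intro i
    induction i with
    | zero => simp
    | succ i ih =>
      refine le_min (min_le_left _ _) ?_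
      have := hT i
      change min (b : ℕ) (i + 1) ≤ _
      omega
  have hb := b.2
  have h1 := h i
  cases i with
  | zero => omega
  | succ i =>
    have := hle i
    omega

/-- Between two deliveries the source is idle, submits, and then serves. While it is idle,
transmitting is not yet optimal by minimality of `threshWait`; at the submission it is, because the
infimum is attained; afterwards `d > 0`. -/
theorem passiveExactlyOn_threshPolicy {lam : ℝ} (hex : ∀ a, ∃ m, s.TransmitOptimal lam (a + m))
    (b : Fin s.B) : s.PassiveExactlyOn (s.threshPolicy lam b) (s.passiveSet lam) := by
  intro T hT t ht
  set π := s.threshPolicy lam b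
  have hex' : ∃ i, t < π.deliver T (i + 1) := ⟨t, π.le_deliver hT (t + 1)⟩
  classical
  obtain ⟨i, hi⟩ : ∃ i, Nat.find hex' = i := ⟨_, rfl⟩
  have h2 : t < π.deliver T (i + 1) := hi ▸ Nat.find_spec hex'
  have h1 : π.deliver T i ≤ t := by
    cases i with
    | zero => rwa [π.deliver_zero]
    | succ i => exact not_lt.1 (Nat.find_min hex' (by omega : i < _))
  have hS := π.submit_succ T i
  have hw : π.wait i T = s.threshWait lam (s.delAge π T i) := s.wait_threshPolicy lam b T i
  have hdlt := π.submit_lt_deliver hT i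
  have hsub := π.deliver_le_submit T i
  rw [s.age_eq π hT h1 h2]
  simp only [passiveSet, Set.mem_ofPred_eq]
  have hnot : π.submit T (i + 1) ≠ t → π.PassiveAt T t := by
    intro hne j hj
    rcases lt_trichotomy (j + 1) (i + 1) with h | h | h
    · have := (π.submit_strictMono hT).monotone (show j + 1 ≤ i by omega)
      omega
    · exact hne (h ▸ hj)
    · have := (π.submit_strictMono hT).monotone (show i + 2 ≤ j + 1 by omega)
      have := π.deliver_le_submit T (i + 1)
      have e : i + 1 + 1 = i + 2 := rfl
      rw [e] at this
      omega
  rcases lt_trichotomy t (π.submit T (i + 1)) with h | h | h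
  · have hb : ¬ π.Busy T t := by
      rw [π.busy_iff hT (by omega) h]
      omega
    refine iff_of_true (hnot (by omega)) (Or.inr ?_)
    exact Nat.notMem_of_lt_sInf (s := {m | s.TransmitOptimal lam (s.delAge π T i + m)})
      (show t - π.deliver T i < s.threshWait lam (s.delAge π T i) by omega)
  · refine iff_of_false (fun hp => hp i h.symm) ?_
    rw [π.elapsed_eq hT h.ge h2]
    have hto : s.TransmitOptimal lam (s.delAge π T i + s.threshWait lam (s.delAge π T i)) :=
      Nat.sInf_mem (hex (s.delAge π T i))
    rw [show t - π.deliver T i = s.threshWait lam (s.delAge π T i) by omega]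
    rintro (h0 | h0)
    · omega
    · exact h0 hto
  · refine iff_of_true (hnot (by omega)) (Or.inl ?_)
    rw [π.elapsed_eq hT h.le h2]
    omega

/-- The expected cost relative to `φ` until the next delivery, for an idle source of age `a` that
waits `m` slots. -/
noncomputable def waitValue (φ : ℕ → ℝ) (a m : ℕ) : ℝ := ageSum φ a m + s.serviceMean φ (a + m)

theorem waitValue_add (φ : ℕ → ℝ) (a m j : ℕ) :
    s.waitValue φ a (m + j) = ageSum φ a m + s.waitValue φ (a + m) j := by
  simp only [waitValue, ageSum_add, add_assoc]

section Bounded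

variable {s} {K : ℝ} (hK : ∀ δ, |s.w * s.p δ| ≤ K)
include hK

theorem cycleCost_eq_waitValue (g : ℝ) (x j : ℕ) :
    s.cycleCost x j = s.waitValue (fun k => s.w * s.p k - g) x j + (j + s.meanTime) * g := by
  have hφ : ∀ k, |s.w * s.p k - g| ≤ K + |g| := fun k =>
    (abs_sub _ _).trans (add_le_add (hK k) le_rfl)
  have h1 := s.integrable_ageSum hφ (x + j)
  have h2 : Integrable (fun t : ℕ => (t : ℝ) * g) s.law.toMeasure := s.law_mean.mul_const g
  have h12 : Integrable (fun t : ℕ => ageSum (fun k => s.w * s.p k - g) (x + j) t + (t : ℝ) * g)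
    s.law.toMeasure := h1.add h2
  have e : ∀ t : ℕ, ∑ k ∈ Finset.range (j + t), s.w * s.p (x + k) =
      (ageSum (fun k => s.w * s.p k - g) x j + j * g) +
        (ageSum (fun k => s.w * s.p k - g) (x + j) t + t * g) := by
    intro t
    rw [Finset.sum_range_add]
    simp only [ageSum, Finset.sum_sub_distrib, Finset.sum_const, Finset.card_range, nsmul_eq_mul,
      add_assoc]
    ring
  unfold cycleCost waitValue serviceMean
  simp only [e]
  rw [integral_add (integrable_const _) h12, integral_add h1 h2, integral_mul_const,
    integral_const, probReal_univ, one_smul, meanTime]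
  ring

/-- By `waitValue_add`, the costs of waiting `m` and `m + j` slots from age `a` share the first `m`
slots. Optimality at age `a + m` thus says that `m` is no worse than any longer wait. -/
theorem transmitOptimal_iff_waitValue {lam g : ℝ} (hg : s.optVal lam = g) (a m : ℕ) :
    s.TransmitOptimal lam (a + m) ↔ ∀ j, s.waitValue (fun k => s.w * s.p k - g) a m ≤
      s.waitValue (fun k => s.w * s.p k - g) a (m + j) := by
  unfold TransmitOptimal
  refine forall_congr' fun j => ?_
  have h0 := s.waitValue_add (fun k => s.w * s.p k - g) a m 0
  rw [add_zero] at h0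
  rw [hg, h0, waitValue_add, add_le_add_iff_left, cycleCost_eq_waitValue hK g,
    cycleCost_eq_waitValue hK g, show ((j : ℕ) : EReal) = ((j : ℝ) : EReal) from rfl,
    ← EReal.coe_mul, ← EReal.coe_add, EReal.coe_le_coe_iff]
  push_cast
  constructor <;> intro h <;> linarith

theorem exists_waitValue_ge {g L : ℝ} (hL : (L : EReal) < s.silentLevel) :
    ∃ C : ℝ, 0 ≤ C ∧ ∀ a m : ℕ, (L - g) * m - C * (1 + (a : ℝ)) ≤
      s.waitValue (fun k => s.w * s.p k - g) a m := by
  have hφ : ∀ k, |s.w * s.p k - g| ≤ K + |g| := fun k =>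
    (abs_sub _ _).trans (add_le_add (hK k) le_rfl)
  have hK0 : 0 ≤ K := (abs_nonneg _).trans (hK 0)
  obtain ⟨C, hC, hW⟩ := s.exists_errSum_ge hL
  have hμ := s.meanTime_nonneg
  refine ⟨C + (K + |g|) * s.meanTime + |L| + K, by positivity, fun a m => ?_⟩
  have h1 := hW (a + m)
  have h2 := (abs_le.1 (abs_ageSum_le hK 0 a)).2
  have h3 := (abs_le.1 (s.abs_serviceMean_le hφ (a + m))).1
  have e : ageSum (fun k => s.w * s.p k - g) a m = s.errSum (a + m) - s.errSum a - m * g := by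
    rw [← s.sum_shift]
    simp [ageSum, Finset.sum_sub_distrib]
  have e2 : ageSum (fun δ => s.w * s.p δ) 0 a = s.errSum a := by simp [ageSum, errSum]
  have ha : (0 : ℝ) ≤ a := Nat.cast_nonneg _
  rw [e2] at h2
  rw [waitValue, e]
  push_cast at h1
  nlinarith [mul_le_mul_of_nonneg_right (neg_abs_le L) ha, abs_nonneg L,
    mul_nonneg (by positivity : 0 ≤ C + (K + |g|) * s.meanTime) ha]

/-- By `exists_waitValue_ge` the value of waiting grows linearly in the wait, so it has a minimizer,
and no longer wait beats a minimizer. -/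
theorem exists_transmitOptimal {lam g : ℝ} (hg : s.optVal lam = g)
    (hlt : s.optVal lam < s.silentLevel) (a : ℕ) : ∃ m, s.TransmitOptimal lam (a + m) := by
  rw [hg] at hlt
  obtain ⟨L, hgL, hL⟩ := EReal.lt_iff_exists_real_btwn.1 hlt
  rw [EReal.coe_lt_coe_iff] at hgL
  obtain ⟨C, hC, h⟩ := exists_waitValue_ge hK (g := g) hL
  set Q := s.waitValue (fun k => s.w * s.p k - g) a with hQ
  obtain ⟨M, hM⟩ := exists_nat_gt ((Q 0 + C * (1 + (a : ℝ))) / (L - g))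
  rw [div_lt_iff₀ (sub_pos.2 hgL)] at hM
  obtain ⟨m, -, hmin⟩ := (Finset.range (M + 1)).exists_min_image Q ⟨0, by simp⟩
  refine ⟨m, (transmitOptimal_iff_waitValue hK hg a m).2 fun j => ?_⟩
  rw [← hQ]
  rcases lt_or_ge (m + j) (M + 1) with hlt | hge
  · exact hmin _ (Finset.mem_range.2 hlt)
  · have h0 := hmin 0 (by simp)
    have hj := h a (m + j)
    have hcast : (M : ℝ) ≤ (m + j : ℕ) := by exact_mod_cast (by omega : M ≤ m + j)
    have := mul_le_mul_of_nonneg_left hcast (sub_pos.2 hgL).le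
    rw [← hQ] at hj
    linarith

/-- A wait shorter than the threshold is strictly beaten by a longer one. Repeating this reaches a
wait at or beyond the threshold, and none of those beats the threshold itself. -/
theorem waitValue_threshWait_le {lam g : ℝ} (hg : s.optVal lam = g)
    (hlt : s.optVal lam < s.silentLevel) (a m : ℕ) :
    s.waitValue (fun k => s.w * s.p k - g) a (s.threshWait lam a) ≤
      s.waitValue (fun k => s.w * s.p k - g) a m := by
  have hto : s.TransmitOptimal lam (a + s.threshWait lam a) :=
    Nat.sInf_mem (exists_transmitOptimal hK hg hlt a)
  rw [transmitOptimal_iff_waitValue hK hg] at hto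
  have key : ∀ d m, s.threshWait lam a ≤ m + d →
      s.waitValue (fun k => s.w * s.p k - g) a (s.threshWait lam a) ≤
        s.waitValue (fun k => s.w * s.p k - g) a m := by
    intro d
    induction d with
    | zero =>
      intro m hm
      simpa [show s.threshWait lam a + (m - s.threshWait lam a) = m by omega] using
        hto (m - s.threshWait lam a)
    | succ d ih =>
      intro m hm
      rcases lt_or_ge m (s.threshWait lam a) with hlt | hge
      · have hnot : ¬ s.TransmitOptimal lam (a + m) :=
          Nat.notMem_of_lt_sInf (s := {m | s.TransmitOptimal lam (a + m)}) hlt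
        rw [transmitOptimal_iff_waitValue hK hg] at hnot
        push Not at hnot
        obtain ⟨j, hj⟩ := hnot
        have hj0 : j ≠ 0 := by
          rintro rfl
          exact lt_irrefl _ hj
        exact (ih (m + j) (by omega)).trans hj.le
      · simpa [show s.threshWait lam a + (m - s.threshWait lam a) = m by omega] using
          hto (m - s.threshWait lam a)
  exact key (s.threshWait lam a) m (by omega)

/-- The linear lower bound on the value of the optimal wait is compared with the value of not
waiting, which is bounded. -/
theorem exists_threshWait_le {lam g : ℝ} (hg : s.optVal lam = g)
    (hlt : s.optVal lam < s.silentLevel) :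
    ∃ C : ℝ, 0 ≤ C ∧ ∀ a : ℕ, (s.threshWait lam a : ℝ) ≤ C * (1 + (a : ℝ)) := by
  have hmin := waitValue_threshWait_le hK hg hlt
  rw [hg] at hlt
  obtain ⟨L, hgL, hL⟩ := EReal.lt_iff_exists_real_btwn.1 hlt
  rw [EReal.coe_lt_coe_iff] at hgL
  obtain ⟨C, hC, h⟩ := exists_waitValue_ge hK (g := g) hL
  have hφ : ∀ k, |s.w * s.p k - g| ≤ K + |g| := fun k =>
    (abs_sub _ _).trans (add_le_add (hK k) le_rfl)
  have hA : 0 ≤ (K + |g|) * s.meanTime :=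
    mul_nonneg ((abs_nonneg _).trans (hφ 0)) s.meanTime_nonneg
  refine ⟨((K + |g|) * s.meanTime + C) / (L - g),
    div_nonneg (by linarith) (sub_pos.2 hgL).le, fun a => ?_⟩
  rw [div_mul_eq_mul_div, le_div_iff₀ (sub_pos.2 hgL)]
  have h1 := (h a (s.threshWait lam a)).trans (hmin a 0)
  have h2 := (abs_le.1 (s.abs_serviceMean_le hφ (a + 0))).2
  have ha : (0 : ℝ) ≤ a := Nat.cast_nonneg _
  simp only [waitValue, ageSum, Finset.range_zero, Finset.sum_empty, zero_add] at h1
  nlinarith [mul_nonneg hA ha]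

end Bounded

end Source

/-! ### Optimality of the threshold policy. -/

namespace Source

variable {s : Source}

section Bounded

variable {K : ℝ} (hK : ∀ δ, |s.w * s.p δ| ≤ K)
include hK

/-- The value of an idle source grows at most linearly in its age. -/
theorem exists_abs_waitValue_le {lam g : ℝ} (hg : s.optVal lam = g)
    (hlt : s.optVal lam < s.silentLevel) :
    ∃ D : ℝ, 0 ≤ D ∧
      (∀ a : ℕ, (K + |g|) * s.threshWait lam a ≤ D * (1 + (a : ℝ))) ∧
      ∀ a : ℕ, |s.waitValue (fun k => s.w * s.p k - g) a (s.threshWait lam a)| ≤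
        D * (1 + (a : ℝ)) := by
  have hφ : ∀ k, |s.w * s.p k - g| ≤ K + |g| := fun k =>
    (abs_sub _ _).trans (add_le_add (hK k) le_rfl)
  have hA : 0 ≤ K + |g| := (abs_nonneg _).trans (hφ 0)
  have hμ := s.meanTime_nonneg
  obtain ⟨C, hC, h⟩ := exists_threshWait_le hK hg hlt
  have h1 : ∀ a : ℕ, (K + |g|) * s.threshWait lam a ≤ (K + |g|) * C * (1 + (a : ℝ)) := fun a => by
    rw [mul_assoc]
    exact mul_le_mul_of_nonneg_left (h a) hA
  have h2 : ∀ a : ℕ, 0 ≤ (K + |g|) * s.meanTime * a := fun a => by positivity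
  refine ⟨(K + |g|) * C + (K + |g|) * s.meanTime, by positivity, fun a => ?_, fun a => ?_⟩
  · nlinarith [h1 a, h2 a, mul_nonneg hA hμ]
  · have e1 := abs_ageSum_le hφ a (s.threshWait lam a)
    have e2 := s.abs_serviceMean_le hφ (a + s.threshWait lam a)
    refine (abs_add_le _ _).trans ?_
    linarith [h1 a, h2 a]

/-- Some buffer position yields cycles whose expected cost is at most the optimal value. -/
theorem exists_pos_cycle_le
    (hint : ∀ δ : ℕ, Integrable (fun T : ℕ => ∑ k ∈ Finset.range T, s.p (δ + k)) s.law.toMeasure)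
    {lam g : ℝ} (hg : s.optVal lam = g) (hlt : s.optVal lam < s.silentLevel) :
    ∃ b : Fin s.B, ∫ t : ℕ, s.waitValue (fun k => s.w * s.p k - g) (t + b)
      (s.threshWait lam (t + b)) ∂s.law.toMeasure + lam * s.meanTime ≤ 0 := by
  -- If every position has a positive cycle value, two lower bounds compete: `hZ` charges `ε / 2`
  -- for each feature on top of `g` per slot, and `h₂` charges `L > g` per slot with a rebate per
  -- feature.
  by_contra! hcon
  have hφ : ∀ k, |s.w * s.p k - g| ≤ K + |g| := fun k =>
    (abs_sub _ _).trans (add_le_add (hK k) le_rfl)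
  have hA : 0 ≤ K + |g| := (abs_nonneg _).trans (hφ 0)
  have hμ := s.meanTime_nonneg
  obtain ⟨D, hD, -, hU⟩ := exists_abs_waitValue_le hK hg hlt
  have hmin := waitValue_threshWait_le hK hg hlt
  set U : ℕ → ℝ := fun a => s.waitValue (fun k => s.w * s.p k - g) a (s.threshWait lam a) with hUdef
  obtain ⟨ε, hε, hεU⟩ : ∃ ε : ℝ, 0 < ε ∧ ∀ b : Fin s.B,
      ε ≤ ∫ t : ℕ, U (t + b) ∂s.law.toMeasure + lam * s.meanTime := by
    have : Nonempty (Fin s.B) := ⟨s.pos₀⟩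
    obtain ⟨b₀, hb₀⟩ := Finite.exists_min
      (fun b : Fin s.B => ∫ t : ℕ, U (t + b) ∂s.law.toMeasure + lam * s.meanTime)
    exact ⟨_, hcon b₀, hb₀⟩
  set C := (K + |g|) * (1 + s.meanTime) with hC
  have hC0 : 0 ≤ C := by positivity
  have hAC : K + |g| ≤ C := by nlinarith [mul_nonneg hA hμ]
  have hA2 : 0 < 2 * C + |lam| + 1 := by positivity
  obtain ⟨R, hR, hη⟩ := s.exists_integral_tail_le (η := ε / 2 / (2 * C + |lam| + 1)) (by positivity)
  have hη' : (2 * C + |lam|) * ∫ t, tail R t ∂s.law.toMeasure ≤ ε / 2 := by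
    rw [le_div_iff₀ hA2] at hη
    have : 0 ≤ ∫ t, tail R t ∂s.law.toMeasure := integral_nonneg fun t => tail_nonneg R t
    linarith
  obtain ⟨Z, hZ⟩ : ∃ Z : ℝ, ∀ (π : Policy s.B) (n : ℕ), ε / 2 * s.meanCount π n - Z ≤
      s.meanAgeTotal π (fun k => s.w * s.p k) n + lam * s.meanOcc π n - n * g := by
    refine ⟨(2 * C + |lam|) * R + C * s.meanTime, fun π n => ?_⟩
    have h := meanAgeTotal_add_ge π n (φ := fun k => s.w * s.p k - g) (C := C)
      (fun k => (hφ k).trans hAC)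
      (V := fun T i => U (s.delAge π T i)) (fun T hT i => hmin _ _)
      (fun T hT i m _ => by
        have e1 := hmin (s.delAge π T i) m
        have e2 := (abs_le.1 (s.abs_serviceMean_le hφ (s.delAge π T i + m))).2
        have e3 : 0 ≤ C * (T i : ℝ) := by positivity
        have e4 : U (s.delAge π T i) ≤ _ := e1
        rw [waitValue] at e4
        linarith)
      (G := fun b t => U (t + b)) (D := D * (1 + s.B)) (by positivity)
      (fun b hb t => by
        refine (hU _).trans ?_
        rw [mul_assoc]
        refine mul_le_mul_of_nonneg_left ?_ hD
        have : (b : ℝ) ≤ s.B := by exact_mod_cast hb.le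
        push_cast
        nlinarith [mul_nonneg (Nat.cast_nonneg (α := ℝ) s.B) (Nat.cast_nonneg (α := ℝ) t)])
      (k := 0) (fun T hT i => by simp [delAge]) (c := ε) (lam := lam)
      (fun b hb => hεU ⟨b, hb⟩) hR
    rw [meanAgeTotal_sub_const] at h
    have := mul_le_mul_of_nonneg_right hη' (s.meanCount_nonneg π n)
    rw [Nat.cast_zero, zero_mul, add_zero, sub_mul] at h
    linarith
  have hlt' := hlt
  rw [hg] at hlt'
  obtain ⟨L, hgL, hL⟩ := EReal.lt_iff_exists_real_btwn.1 hlt'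
  rw [EReal.coe_lt_coe_iff] at hgL
  obtain ⟨C₁, hC₁, h₁⟩ := s.exists_meanAgeTotal_ge hint hL
  set C₂ := C₁ + |lam| * s.meanTime with hC₂def
  have hC₂ : 0 ≤ C₂ := by positivity
  have h₂ : ∀ (π : Policy s.B) (n : ℕ), L * n - C₂ * s.meanCount π n - C₁ ≤
      s.meanAgeTotal π (fun k => s.w * s.p k) n + lam * s.meanOcc π n := by
    intro π n
    have e1 := h₁ π n
    have e2 := mul_le_mul_of_nonneg_left (s.meanOcc_le_mul_meanCount π n) (abs_nonneg lam)
    have e3 := mul_le_mul_of_nonneg_right (neg_abs_le lam) (s.meanOcc_nonneg π n)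
    rw [hC₂def]
    linarith
  have hden : 0 < C₂ + ε / 2 := by linarith
  -- Adding `C₂` times the first bound to `ε / 2` times the second cancels the number of features.
  -- What remains exceeds `g` per slot by `κ`, up to a constant; half of `κ` absorbs the constant at
  -- large horizons.
  set κ := ε / 2 * (L - g) / (C₂ + ε / 2) with hκ
  have hκ0 : 0 < κ := div_pos (mul_pos (by linarith) (by linarith)) hden
  have hκ' : κ * (C₂ + ε / 2) = ε / 2 * (L - g) := div_mul_cancel₀ _ hden.ne'
  have hfin : ((g + κ / 2 : ℝ) : EReal) ≤ s.optVal lam := by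
    refine le_iInf fun π => s.le_avgCost ?_
    obtain ⟨N, hN⟩ := exists_nat_gt ((C₂ * Z + ε / 2 * C₁) / (C₂ + ε / 2) / (κ / 2))
    filter_upwards [eventually_ge_atTop (N + 1)] with n hn
    have hn' : (N : ℝ) + 1 ≤ n := by exact_mod_cast hn
    have hN0 : (0 : ℝ) ≤ N := Nat.cast_nonneg _
    rw [meanCost, one_div, inv_mul_eq_div, le_div_iff₀ (by linarith)]
    rw [div_lt_iff₀ (by linarith), div_lt_iff₀ hden] at hN
    have e1 := mul_le_mul_of_nonneg_left (hZ π n) hC₂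
    have e2 := mul_le_mul_of_nonneg_left (h₂ π n) (by linarith : 0 ≤ ε / 2)
    set Y := s.meanAgeTotal π (fun k => s.w * s.p k) n + lam * s.meanOcc π n
    refine le_of_mul_le_mul_right ?_ hden
    have e3 : (N : ℝ) * (κ / 2) * (C₂ + ε / 2) ≤ n * (κ / 2) * (C₂ + ε / 2) := by
      have : (N : ℝ) ≤ n := by linarith
      gcongr
    have e4 : n * (κ / 2) * (C₂ + ε / 2) = n * (ε / 2 * (L - g)) / 2 := by
      rw [← hκ']
      ring
    have e5 : (g + κ / 2) * n * (C₂ + ε / 2) =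
        g * n * (C₂ + ε / 2) + n * (κ / 2) * (C₂ + ε / 2) := by ring
    rw [e5]
    nlinarith
  rw [hg, EReal.coe_le_coe_iff] at hfin
  linarith

/-- The threshold policy is optimal if its buffer position yields cheap enough cycles. -/
theorem avgCost_threshPolicy_le {lam g : ℝ} (hg : s.optVal lam = g)
    (hlt : s.optVal lam < s.silentLevel) {b : Fin s.B}
    (hb : ∫ t : ℕ, s.waitValue (fun k => s.w * s.p k - g) (t + b)
      (s.threshWait lam (t + b)) ∂s.law.toMeasure + lam * s.meanTime ≤ 0) :
    s.avgCost lam (s.threshPolicy lam b) ≤ g := by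
  have hφ : ∀ k, |s.w * s.p k - g| ≤ K + |g| := fun k =>
    (abs_sub _ _).trans (add_le_add (hK k) le_rfl)
  have hφ' : ∀ k, |g - s.w * s.p k| ≤ K + |g| := fun k => by rw [abs_sub_comm]; exact hφ k
  have hA : 0 ≤ K + |g| := (abs_nonneg _).trans (hφ 0)
  have hμ := s.meanTime_nonneg
  obtain ⟨D, hD, hW, hU⟩ := exists_abs_waitValue_le hK hg hlt
  set U : ℕ → ℝ := fun a => s.waitValue (fun k => s.w * s.p k - g) a (s.threshWait lam a) with hUdef
  set π := s.threshPolicy lam b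
  have hneg : ∀ x m, ageSum (fun k => g - s.w * s.p k) x m =
      - ageSum (fun k => s.w * s.p k - g) x m := by
    intro x m
    rw [ageSum, ageSum, ← Finset.sum_neg_distrib]
    exact Finset.sum_congr rfl fun k _ => (neg_sub _ _).symm
  have hnegS : ∀ x, s.serviceMean (fun k => g - s.w * s.p k) x =
      - s.serviceMean (fun k => s.w * s.p k - g) x := by
    intro x
    simp only [serviceMean, hneg, integral_neg]
  have hB0 : (0 : ℝ) ≤ s.B := Nat.cast_nonneg _
  have hlin : ∀ (t c : ℕ), c < s.B → D * (1 + ((t + c : ℕ) : ℝ)) ≤ D * (1 + s.B) * (1 + (t : ℝ)) := by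
    intro t c hc
    rw [mul_assoc]
    refine mul_le_mul_of_nonneg_left ?_ hD
    have : (c : ℝ) ≤ s.B := by exact_mod_cast hc.le
    push_cast
    nlinarith [mul_nonneg hB0 (Nat.cast_nonneg (α := ℝ) t)]
  -- The factor 2 allows for two values of `U`: one at the actual delivery age, one at the age with
  -- offset exactly `b`.
  set D' := 2 * (D * (1 + s.B)) with hD'
  have hD'0 : 0 ≤ D' := by positivity
  set C := K + |g| + D' with hC
  have hC0 : 0 ≤ C := by positivity
  have key : ∀ R : ℝ, 0 ≤ R → ∀ n : ℕ,
      s.meanAgeTotal π (fun k => s.w * s.p k) n + lam * s.meanOcc π n ≤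
        n * g + (2 * C + |lam|) * (∫ t, tail R t ∂s.law.toMeasure) * n +
        ((2 * C + |lam|) * R + C * s.meanTime + s.B * (D' * (1 + s.meanTime))) := by
    intro R hR n
    -- For the negated cost and `-lam` the lower estimate becomes an upper one. Its first
    -- requirement now holds with equality, since the policy waits exactly `threshWait`.
    have h := meanAgeTotal_add_ge π n (φ := fun k => g - s.w * s.p k) (C := C)
      (fun k => (hφ' k).trans (by linarith))
      (V := fun T i => - U (s.delAge π T i))
      (fun T hT i => by
        rw [hneg, hnegS, wait_threshPolicy]
        change _ ≤ - _ + - s.serviceMean _ (s.delAge π T i + π.wait i T)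
        rw [wait_threshPolicy]
        simp only [hUdef, waitValue, neg_add]
        rfl)
      (fun T hT i m hm => by
        rw [wait_threshPolicy] at hm
        rw [hneg]
        have e1 := (abs_le.1 (abs_ageSum_le hφ (s.delAge π T i) m)).2
        have e2 : (K + |g|) * (m : ℝ) ≤ (K + |g|) * s.threshWait lam (s.delAge π T i) :=
          mul_le_mul_of_nonneg_left (by exact_mod_cast hm) hA
        have e3 := hW (s.delAge π T i)
        have e4 := (abs_le.1 (hU (s.delAge π T i))).1
        have e5 := hlin (T i) _ (s.effPos_lt π T i)
        have e6 : 0 ≤ (K + |g|) * (1 + (T i : ℝ)) := by positivity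
        have e7 : C * (1 + (T i : ℝ)) = (K + |g|) * (1 + (T i : ℝ)) +
          2 * (D * (1 + s.B) * (1 + (T i : ℝ))) := by rw [hC, hD']; ring
        have e8 : -(D * (1 + ((T i + s.effPos π T i : ℕ) : ℝ))) ≤ U (s.delAge π T i) := e4
        simp only [delAge] at *
        linarith)
      (G := fun _ t => - U (t + b)) (D := D') hD'0
      (fun c hc t => by
        rw [abs_neg]
        refine (hU _).trans ((hlin t b b.2).trans ?_)
        have : 0 ≤ D * (1 + s.B) * (1 + (t : ℝ)) := by positivity
        rw [hD']
        linarith)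
      -- Only the first `B` features may have an offset different from `b`; they contribute a
      -- constant.
      (k := s.B)
      (fun T hT i => by
        split_ifs with hi
        · have e1 := (abs_le.1 (hU (T i + b))).1
          have e2 := (abs_le.1 (hU (s.delAge π T i))).2
          have e3 := hlin (T i) _ (s.effPos_lt π T i)
          have e4 := hlin (T i) b b.2
          simp only [hD', hUdef, delAge] at *
          linarith
        · rw [delAge, s.effPos_threshPolicy lam b hT (not_lt.1 hi), sub_zero])
      (c := 0) (lam := -lam)
      (fun c hc => by
        rw [integral_neg]
        linarith) hR
    have hconst := s.meanAgeTotal_sub_const π (fun k => s.w * s.p k) g n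
    have hsub : s.meanAgeTotal π (fun k => g - s.w * s.p k) n =
        - s.meanAgeTotal π (fun k => s.w * s.p k - g) n := by
      rw [meanAgeTotal, meanAgeTotal, ← integral_neg]
      refine integral_congr_ae ?_
      filter_upwards [s.ae_seqLaw] with T hT
      rw [← s.sum_age π hT, ← s.sum_age π hT, ← Finset.sum_neg_distrib]
      exact Finset.sum_congr rfl fun t _ => (neg_sub _ _).symm
    rw [hsub, hconst, abs_neg] at h
    have hcnt := (s.meanCount_le_meanOcc π n).trans (s.meanOcc_le π n)
    have htail : 0 ≤ (2 * C + |lam|) * ∫ t, tail R t ∂s.law.toMeasure :=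
      mul_nonneg (by positivity) (integral_nonneg fun t => tail_nonneg R t)
    have := mul_le_mul_of_nonneg_left hcnt htail
    linarith
  by_contra! hcon
  obtain ⟨g', hgg', hg'⟩ := EReal.lt_iff_exists_real_btwn.1 hcon
  rw [EReal.coe_lt_coe_iff] at hgg'
  have hη : 0 < (g' - g) / 2 / (2 * C + |lam| + 1) :=
    div_pos (by linarith) (by positivity)
  obtain ⟨R, hR, htail⟩ := s.exists_integral_tail_le hη
  rw [le_div_iff₀ (by positivity)] at htail
  have ht0 : 0 ≤ ∫ t, tail R t ∂s.law.toMeasure := integral_nonneg fun t => tail_nonneg R t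
  obtain ⟨Z, hZ⟩ : ∃ Z : ℝ, Z =
    (2 * C + |lam|) * R + C * s.meanTime + s.B * (D' * (1 + s.meanTime)) := ⟨_, rfl⟩
  obtain ⟨N, hN⟩ := exists_nat_gt (Z / ((g' - g) / 2))
  rw [div_lt_iff₀ (by linarith)] at hN
  refine absurd hg' (not_lt.2 ?_)
  rw [avgCost_eq]
  refine limsup_le_of_le (by isBoundedDefault) ?_
  filter_upwards [eventually_ge_atTop (N + 1)] with n hn
  rw [EReal.coe_le_coe_iff]
  have hn' : (N : ℝ) + 1 ≤ n := by exact_mod_cast hn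
  have hN0 : (0 : ℝ) ≤ N := Nat.cast_nonneg _
  have hn0 : (0 : ℝ) < n := by linarith
  rw [meanCost, one_div, inv_mul_eq_div, div_le_iff₀ hn0]
  have h1 := key R hR n
  rw [← hZ] at h1
  have h2 : (2 * C + |lam|) * (∫ t, tail R t ∂s.law.toMeasure) * n ≤ (g' - g) / 2 * n :=
    mul_le_mul_of_nonneg_right (by linarith) hn0.le
  nlinarith

end Bounded

end Source

/-! ### The dummy bandits. -/

namespace RMAB

variable (R : RMAB)

theorem passiveSet_none_of_pos {lam : ℝ} (h : 0 < lam) : R.passiveSet none lam = Set.univ := by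
  refine Set.eq_univ_of_forall fun x hx => ?_
  have := hx 0
  simp only [mul_one, Fin.val_zero, Nat.cast_zero, mul_zero] at this
  linarith

theorem passiveSet_none_of_nonpos {lam : ℝ} (h : lam ≤ 0) : R.passiveSet none lam = ∅ := by
  refine Set.eq_empty_of_forall_notMem fun x hx => hx fun a => ?_
  refine mul_le_mul_of_nonpos_left ?_ h
  exact_mod_cast Nat.lt_succ_iff.1 a.2

theorem isOptimalDummy_of_le {lam : ℝ} {a : Fin (R.N + 1)}
    (h : ∀ a' : Fin (R.N + 1), lam * ((a : ℕ) : ℝ) ≤ lam * ((a' : ℕ) : ℝ)) :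
    R.IsOptimalDummy lam (fun _ => a) := by
  intro c'
  refine limsup_le_limsup (Eventually.of_forall fun n => EReal.coe_le_coe_iff.2 ?_)
  exact mul_le_mul_of_nonneg_left (Finset.sum_le_sum fun t _ => h (c' t)) (by positivity)

end RMAB

theorem theorem9 (R : RMAB)
    (hint : ∀ (m : Fin R.M) (δ : ℕ),
      Integrable (fun T : ℕ => ∑ k ∈ Finset.range T, (R.source m).p (δ + k))
        (R.source m).law.toMeasure) :
    R.Indexable ∧
    -- the sources
    (∀ m : Fin R.M,
      (∀ lam : ℝ, R.passiveSet (some m) lam =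
        {x : ℕ × ℕ | 0 < x.2 ∨ (R.source m).gam x.1 < (R.source m).optVal lam}) ∧
      Monotone (R.source m).optVal ∧
      (∀ lam₁ lam₂ : ℝ, lam₁ < lam₂ →
        (R.source m).optVal lam₁ < (R.source m).silentLevel →
        (R.source m).optVal lam₁ < (R.source m).optVal lam₂) ∧
      ((∃ K : ℝ, ∀ δ, |(R.source m).p δ| ≤ K) →
        ∀ lam : ℝ, (R.source m).optVal lam < (R.source m).silentLevel →
          ∃ (π : Policy (R.source m).B) (b : Fin (R.source m).B),
            (∀ i T, π.pos i T = b) ∧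
            (R.source m).PassiveExactlyOn π (R.passiveSet (some m) lam) ∧
            (R.source m).IsOptimalPolicy lam π)) ∧
    -- the dummy bandits
    (∀ lam : ℝ,
      (0 < lam → R.passiveSet none lam = Set.univ ∧ R.IsOptimalDummy lam (fun _ => 0)) ∧
      (lam ≤ 0 → R.passiveSet none lam = ∅ ∧
        R.IsOptimalDummy lam (fun _ => Fin.last R.N))) := by
  have hset : ∀ (m : Fin R.M) (lam : ℝ), R.passiveSet (some m) lam =
      {x : ℕ × ℕ | 0 < x.2 ∨ (R.source m).gam x.1 < (R.source m).optVal lam} := by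
    intro m lam
    ext x
    exact or_congr_right
      ((not_congr (Source.transmitOptimal_iff (hint m) lam x.1)).trans not_le)
  refine ⟨?_, fun m => ⟨hset m, (R.source m).optVal_mono, fun _ _ => (R.source m).optVal_strict
    (hint m), ?_⟩, fun lam => ⟨fun h => ⟨R.passiveSet_none_of_pos h, ?_⟩,
    fun h => ⟨R.passiveSet_none_of_nonpos h, ?_⟩⟩⟩
  · rintro (_ | m) lam₁ lam₂ h
    · rcases lt_or_ge 0 lam₂ with h₂ | h₂
      · rw [R.passiveSet_none_of_pos h₂]
        exact Set.subset_univ _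
      · rw [R.passiveSet_none_of_nonpos (h.trans h₂)]
        exact Set.empty_subset _
    · rw [hset, hset]
      rintro x (hx | hx)
      · exact Or.inl hx
      · exact Or.inr (hx.trans_le ((R.source m).optVal_mono h))
  · rintro ⟨K, hK⟩ lam hlt
    have hK' : ∀ δ, |(R.source m).w * (R.source m).p δ| ≤ (R.source m).w * K := fun δ => by
      rw [abs_mul, abs_of_pos (R.source m).w_pos]
      exact mul_le_mul_of_nonneg_left (hK δ) (R.source m).w_pos.le
    obtain ⟨g, hg⟩ : ∃ g : ℝ, (R.source m).optVal lam = g :=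
      ⟨((R.source m).optVal lam).toReal, (EReal.coe_toReal hlt.ne_top
        ((R.source m).optVal_ne_bot (hint m) (bot_le.trans_lt hlt).ne' lam)).symm⟩
    obtain ⟨b, hb⟩ := Source.exists_pos_cycle_le hK' (hint m) hg hlt
    refine ⟨(R.source m).threshPolicy lam b, b, fun _ _ => rfl,
      (R.source m).passiveExactlyOn_threshPolicy
        (Source.exists_transmitOptimal hK' hg hlt) b, le_antisymm ?_ (iInf_le _ _)⟩
    rw [hg]
    exact Source.avgCost_threshPolicy_le hK' hg hlt hb
  · refine R.isOptimalDummy_of_le fun a' => ?_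
    simp only [Fin.val_zero, Nat.cast_zero, mul_zero]
    positivity
  · refine R.isOptimalDummy_of_le fun a' => mul_le_mul_of_nonpos_left ?_ h
    exact_mod_cast a'.le_last
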